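/- Let $T$ be a complete first-order theory in a language $L$, let $|T| = \max(\aleph_0, |L|)$, and let $\mathbb{M} \models T$ be a monster model: $\mathbb{M}$ is $\bar\kappa$-saturated and strongly $\bar\kappa$-homogeneous for some cardinal $\bar\kappa > |T|^+$. A subset of $\mathbb{M}$ is small if its cardinality is $< \bar\kappa$; below, $A, A', B, B'$ are small sets and $M$ is a small elementary submodel of $\mathbb{M}$. For sets, $A \equiv_C A'$ means that suitable enumerations of $A$ and $A'$ have the same type over $C$. An independence relation is an $\mathrm{Aut}(\mathbb{M})$-invariant ternary relation $A \mathop{\perp}_M B$. It satisfies - full existence if for all $A, B, M$ there is $A' \equiv_M A$ with $A' \perp_M B$; - monotonicity if $A \perp_M B$, $A' \subseteq A$, $B' \subseteq B$ imply $A' \perp_M B'$; - strong finite character if, whenever $A \not\perp_M B$ and $a$ enumerates $A$, there is a formula $\phi(x) \in \mathrm{tp}(a/MB)$ such that $a' \not\perp_M B$ for all $a' \models \phi$; - right extension if $A \perp_M B \subseteq B'$ implies that there is $A' \equiv_{MB} A$ with $A' \perp_M B'$; - chain local character if, for every finite $A$, every regular cardinal $\kappa$ with $|T| < \kappa < \bar\kappa$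 and every continuous increasing chain $(M_i)_{i<\kappa}$ of elementary submodels of $\mathbb{M}$ with $|M_i| < \kappa$ for all $i<\kappa$, there is $i < \kappa$ with $A \perp_{M_i} \bigcup_{j<\kappa} M_j$. A global type $q$ is $\perp$-free over $M$ if $a \perp_M B$ for all small $B$ and all $a \models q|_{MB}$. A sequence $(b_i)_{i<\omega}$ is a Morley sequence in $q$ over $M$ if $b_i \models q|_{M b_{<i}}$ for all $i$. For an $L_M$-formula $\phi(x,y)$ and a finite tuple $b$, the formula $\phi(x,b)$ $\perp$-Conant-divides over $M$ if, for every global extension $q$ of $\mathrm{tp}(b/M)$ that is $\perp$-free over $M$ and every $M$-indiscernible Morley sequence $(b_i)_{i<\omega}$ in $q$ over $M$ with $b_0 = b$, the set $\{\phi(x,b_i) : i<\omega\}$ is inconsistent. A formula $\perp$-Conant-forks over $M$ if it implies a finite disjunction of formulas that $\perp$-Conant-divide over $M$. The set $A$ is $\perp$-Conant-independent from $B$ over $M$ if no formula in $\mathrm{tp}(a/MB)$, where $a$ enumerates $A$, $\perp$-Conant-forks over $M$. Conant-independence is $\perp^{\mathrm{i}}$-Conant-independence, where $A \perp^{\mathrm{i}}_M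 B$ means that $\mathrm{tp}(a/MB)$ extends to a global $\mathrm{Aut}(\mathbb{M}/M)$-invariant type. **Corollary.** If $\perp$ is an independence relation satisfying full existence, monotonicity, strong finite character and right extension, then $\perp$-Conant-independence satisfies chain local character. In particular, for every $T$ and $\mathbb{M}$ as above, Conant-independence satisfies chain local character. -/

import Mathlib

universe u v w w'

namespace AbsIndep

open FirstOrder FirstOrder.Language Cardinal Set

section Monster

variable (L : FirstOrder.Language.{u, v}) (𝕄 : Type w) [L.Structure 𝕄]

/-- `|T|`, the number of formulas of the language up to renaming of variables:
the maximum of `ℵ₀` and the number of symbols. -/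
noncomputable def theoryCard : Cardinal.{max u v} := max ℵ₀ L.card

/-- `𝕄` is a monster model (of its complete theory) with respect to the cardinal `κ`:
`κ > |T|⁺`, and `𝕄` is `κ`-saturated and strongly `κ`-homogeneous.
The small sets are the subsets of `𝕄` of cardinality `< κ`; the small models of the theory
are the elementary substructures of `𝕄` of cardinality `< κ`. -/
structure IsMonster (κ : Cardinal.{w}) : Prop where
  card_lt : Cardinal.lift.{w} (Order.succ (theoryCard L)) < Cardinal.lift.{max u v} κ
  saturated : ∀ C : Set 𝕄, #C < κ → ∀ (n : ℕ) (p : Set (L[[C]].Formula (Fin n))),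
    (∀ s : Finset (L[[C]].Formula (Fin n)), (s : Set (L[[C]].Formula (Fin n))) ⊆ p →
      ∃ a : Fin n → 𝕄, ∀ φ ∈ s, φ.Realize a) →
    ∃ a : Fin n → 𝕄, ∀ φ ∈ p, φ.Realize a
  homogeneous : ∀ C : Set 𝕄, #C < κ → ∀ f : C → 𝕄,
    (∀ φ : L.Formula C, φ.Realize (fun c => (c : 𝕄)) ↔ φ.Realize f) →
    ∃ σ : 𝕄 ≃[L] 𝕄, ∀ c : C, σ c = f c

end Monster

section Types

variable (L : FirstOrder.Language.{u, v}) {𝕄 : Type w} [L.Structure 𝕄] {ι : Type w'}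

/-- `a ≡_C a'` for tuples: `tp(a/C) = tp(a'/C)`. -/
def SameType (C : Set 𝕄) (a a' : ι → 𝕄) : Prop :=
  ∀ φ : L[[C]].Formula ι, φ.Realize a ↔ φ.Realize a'

/-- `A ≡_C A'` for sets: the enumeration of `A` by its own elements has the same type over `C`
as some enumeration of `A'`. -/
def SetSameType (C A A' : Set 𝕄) : Prop :=
  ∃ f : A → 𝕄, range f = A' ∧ SameType L C (fun x : A => (x : 𝕄)) f

variable (𝕄) in
/-- Global types in the variables `ι`: complete types over `𝕄`. -/
abbrev GlobalType (ι : Type w') := (L.elementaryDiagram 𝕄).CompleteType ι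

variable {L}

/-- The formula `φ` with parameters in `𝕄` belongs to the global type `p`. -/
def GlobalType.Contains (p : GlobalType L 𝕄 ι) (φ : L[[𝕄]].Formula ι) : Prop :=
  Formula.equivSentence φ ∈ p

/-- `a ⊨ p|_C`. For `C = M` this says equally that `p` extends `tp(a/M)`. -/
def GlobalType.RealizesRestrict (p : GlobalType L 𝕄 ι) (C : Set 𝕄) (a : ι → 𝕄) : Prop :=
  ∀ φ : L[[C]].Formula ι,
    p.Contains ((L.lhomWithConstantsMap (Subtype.val : C → 𝕄)).onFormula φ) → φ.Realize a

/-- `p` is invariant under `Aut(𝕄/C)`. -/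
def GlobalType.IsInvariant (p : GlobalType L 𝕄 ι) (C : Set 𝕄) : Prop :=
  ∀ σ : 𝕄 ≃[L] 𝕄, (∀ c ∈ C, σ c = c) → ∀ φ : L[[𝕄]].Formula ι,
    p.Contains φ ↔ p.Contains ((L.lhomWithConstantsMap σ).onFormula φ)

/-- `(a_i)_{i<ω}` is a Morley sequence in `p` over `C`: `a_i ⊨ p|_{C a_{<i}}` for all `i`. -/
def IsMorleyIn (p : GlobalType L 𝕄 ι) (C : Set 𝕄) (a : ℕ → ι → 𝕄) : Prop :=
  ∀ i, p.RealizesRestrict (C ∪ ⋃ j < i, range (a j)) (a i)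

variable (L) in
/-- The sequence of tuples `(a_i)_{i<ω}` is (order-)indiscernible over `C`. -/
def IsIndiscernible (C : Set 𝕄) (a : ℕ → ι → 𝕄) : Prop :=
  ∀ (n : ℕ) (i j : Fin n → ℕ), StrictMono i → StrictMono j →
    SameType L C (fun x : Fin n × ι => a (i x.1) x.2) (fun x : Fin n × ι => a (j x.1) x.2)

end Types

/-- Ternary relations between subsets of `𝕄`; `Ind A C B` is read `A ⫝_C B`. Only the values at
small `A`, `B` and small models `C` matter below. -/
abbrev TernaryRel (𝕄 : Type w) := Set 𝕄 → Set 𝕄 → Set 𝕄 → Prop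

section Properties

variable (L : FirstOrder.Language.{u, v}) {𝕄 : Type w} [L.Structure 𝕄] (κ : Cardinal.{w})
  (Ind : TernaryRel 𝕄)

/-- Independence relations: the `Aut(𝕄)`-invariant ternary relations. -/
def IsIndependenceRelation : Prop :=
  ∀ (σ : 𝕄 ≃[L] 𝕄) (A C B : Set 𝕄), Ind A C B → Ind (σ '' A) (σ '' C) (σ '' B)

def FullExistence : Prop :=
  ∀ (M : L.ElementarySubstructure 𝕄) (A B : Set 𝕄),
    #(M : Set 𝕄) < κ → #A < κ → #B < κ → ∃ A', SetSameType L M A A' ∧ Ind A' M B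

def LeftMonotonicity : Prop :=
  ∀ (M : L.ElementarySubstructure 𝕄) (A A' B : Set 𝕄),
    #(M : Set 𝕄) < κ → #A < κ → #B < κ → Ind A M B → A' ⊆ A → Ind A' M B

def RightMonotonicity : Prop :=
  ∀ (M : L.ElementarySubstructure 𝕄) (A B B' : Set 𝕄),
    #(M : Set 𝕄) < κ → #A < κ → #B < κ → Ind A M B → B' ⊆ B → Ind A M B'

def Monotonicity : Prop := LeftMonotonicity L κ Ind ∧ RightMonotonicity L κ Ind

/-- If not `A ⫝_M B`, then some formula in `tp(A/MB)` implies dependence from `B` over `M`. -/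
def StrongFiniteCharacter : Prop :=
  ∀ (M : L.ElementarySubstructure 𝕄) (A B : Set 𝕄),
    #(M : Set 𝕄) < κ → #A < κ → #B < κ → ¬ Ind A M B →
    ∃ φ : L[[((M : Set 𝕄) ∪ B : Set 𝕄)]].Formula A,
      φ.Realize (fun x : A => (x : 𝕄)) ∧
      ∀ a' : A → 𝕄, φ.Realize a' → ¬ Ind (range a') M B

def RightExtension : Prop :=
  ∀ (M : L.ElementarySubstructure 𝕄) (A B B' : Set 𝕄),
    #(M : Set 𝕄) < κ → #A < κ → #B < κ → #B' < κ → Ind A M B → B ⊆ B' →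
    ∃ A', SetSameType L ((M : Set 𝕄) ∪ B) A A' ∧ Ind A' M B'

/-- `(M_i)_{i<μ}` is a continuous chain of models (only the values at ordinals `i < μ` matter). -/
def IsContinuousChain (μ : Cardinal.{w}) (M : Ordinal.{w} → L.ElementarySubstructure 𝕄) : Prop :=
  (∀ i j, i ≤ j → j < μ.ord → (M i : Set 𝕄) ⊆ M j) ∧
  (∀ i, i < μ.ord → Order.IsSuccLimit i → (M i : Set 𝕄) = ⋃ j < i, (M j : Set 𝕄))

/-- Chain local character: for every finite `A` and every regular cardinal `μ > |T|` (small with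
respect to the monster), every continuous chain `(M_i)_{i<μ}` of models of cardinality `< μ`
has a member `M_i` such that `A ⫝_{M_i} ⋃_{j<μ} M_j`. -/
def ChainLocalCharacter : Prop :=
  ∀ A : Set 𝕄, A.Finite → ∀ μ : Cardinal.{w}, μ.IsRegular → μ < κ →
    Cardinal.lift.{w} (theoryCard L) < Cardinal.lift.{max u v} μ →
    ∀ M : Ordinal.{w} → L.ElementarySubstructure 𝕄, IsContinuousChain L μ M →
      (∀ i < μ.ord, #(M i : Set 𝕄) < μ) →
      ∃ i < μ.ord, Ind A (M i) (⋃ j < μ.ord, (M j : Set 𝕄))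

end Properties

section Conant

variable {L : FirstOrder.Language.{u, v}} {𝕄 : Type w} [L.Structure 𝕄] (κ : Cardinal.{w})
  (Ind : TernaryRel 𝕄)

/-- The global type `p` is `⫝`-free over `M`: if `B` is small and `a ⊨ p|_{MB}`,
then `a ⫝_M B`. -/
def IsFree {ι : Type w'} (p : GlobalType L 𝕄 ι) (M : Set 𝕄) : Prop :=
  ∀ B : Set 𝕄, #B < κ → ∀ a : ι → 𝕄, p.RealizesRestrict (M ∪ B) a → Ind (range a) M B

/-- `φ(x, b)` `⫝`-Conant-divides over `M`, where `φ(x, y)` has parameters in `M`: for every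
`⫝`-free global extension `q` of `tp(b/M)` and every `M`-indiscernible Morley sequence `(b_i)`
in `q` over `M` with `b_0 = b`, some finite part of `{φ(x, b_i) : i < ω}` has no solution. -/
def ConantDivides {α : Type w'} {m : ℕ} (M : Set 𝕄) (φ : L[[M]].Formula (α ⊕ Fin m))
    (b : Fin m → 𝕄) : Prop :=
  ∀ q : GlobalType L 𝕄 (Fin m), q.RealizesRestrict M b → IsFree κ Ind q M →
    ∀ c : ℕ → Fin m → 𝕄, IsMorleyIn q M c → IsIndiscernible L M c → c 0 = b →
      ∃ s : Finset ℕ, ¬ ∃ x : α → 𝕄, ∀ i ∈ s, φ.Realize (Sum.elim x (c i))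

/-- `φ` (a formula with parameters in `D`) `⫝`-Conant-forks over `M`: it implies a finite
disjunction of formulas `ψ_i(x, c_i)` each of which `⫝`-Conant-divides over `M`. -/
def ConantForks {α : Type w'} (M : Set 𝕄) {D : Set 𝕄} (φ : L[[D]].Formula α) : Prop :=
  ∃ (n : ℕ) (m : Fin n → ℕ) (ψ : ∀ i, L[[M]].Formula (α ⊕ Fin (m i)))
    (c : ∀ i, Fin (m i) → 𝕄),
    (∀ i, ConantDivides κ Ind M (ψ i) (c i)) ∧
    ∀ x : α → 𝕄, φ.Realize x → ∃ i, (ψ i).Realize (Sum.elim x (c i))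

variable (L)

/-- `⫝`-Conant-independence: no formula of `tp(A/MB)` `⫝`-Conant-forks over `M`. -/
def ConantIndep : TernaryRel 𝕄 := fun A M B =>
  ¬ ∃ φ : L[[(M ∪ B : Set 𝕄)]].Formula A,
    φ.Realize (fun x : A => (x : 𝕄)) ∧ ConantForks κ Ind M φ

/-- `A ⫝ⁱ_M B`: `tp(A/MB)` extends to a global `M`-invariant type. -/
def InvIndep : TernaryRel 𝕄 := fun A M B =>
  ∃ q : GlobalType L 𝕄 A, q.IsInvariant M ∧ q.RealizesRestrict (M ∪ B) (fun x : A => (x : 𝕄))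

end Conant

end AbsIndep

universe x y

namespace AbsIndep

open FirstOrder FirstOrder.Language Cardinal Set Filter

/-!
Fix a finite set `A` and a continuous chain `(M_i)_{i<μ}` with union `C`. For some limit stage
`i`, the type of every finite tuple of `C` over `M_i ∪ A` is finitely satisfiable in `N = M_i`.
Finite tuples of `N` are independent from `A` over `N`, so finite satisfiability and strong
finite character allow parameters of formulas over `NC` to be moved, fixing the parameters in
`N` and a given finite part of `C`, to parameters that are independent from `A` over `N`.

If a formula of `tp(A/NC)` implied a finite disjunction of Conant-dividing formulas, then, after
moving the parameters, some `φ(x, b)` that Conant-divides over `N` would be true of a tuple `a` with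
`b` independent from `a`. But from such a `b` right extension produces arbitrarily long free
sequences over `Na`, the Erdős–Rado theorem extracts from them a free `Na`-indiscernible sequence
`(b_n)` with `b_0 = b`, and strong finite character gives a global free type in which `(b_n)` is
a Morley sequence over `N`. As `a` satisfies every `φ(x, b_n)`, the formula does not Conant-divide.
-/

section Definable

variable {L : FirstOrder.Language.{u, v}} {𝕄 : Type w} [L.Structure 𝕄]
  {α : Type x} {β : Type y} {C D : Set 𝕄}

theorem definable_range_iff {w : β → 𝕄} {S : Set (α → 𝕄)} :
    (range w).Definable L S ↔ ∃ φ : L.Formula (β ⊕ α), S = {x | φ.Realize (Sum.elim w x)} := by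
  rw [definable_iff_exists_formula_sum]
  constructor
  · rintro ⟨φ, rfl⟩
    refine ⟨φ.relabel (Sum.map (rangeSplitting w) id), ?_⟩
    simp only [Formula.realize_relabel, Sum.elim_comp_map, Function.comp_id, comp_rangeSplitting]
  · rintro ⟨φ, rfl⟩
    refine ⟨φ.relabel (Sum.map (rangeFactorization w) id), ?_⟩
    simp only [Formula.realize_relabel, Sum.elim_comp_map, Function.comp_id,
      coe_comp_rangeFactorization]

theorem definable_union_range_iff {e : β → 𝕄} {S : Set (α → 𝕄)} :
    (C ∪ range e).Definable L S ↔
      ∃ T : Set (α ⊕ β → 𝕄), C.Definable L T ∧ S = {x | Sum.elim x e ∈ T} := by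
  have hrange : C ∪ range e = range (Sum.elim ((↑) : C → 𝕄) e) := by
    rw [Sum.elim_range, Subtype.range_coe]
  rw [hrange, definable_range_iff]
  simp only [definable_iff_exists_formula_sum]
  let reorder : (C ⊕ β) ⊕ α ≃ C ⊕ (α ⊕ β) :=
    (Equiv.sumAssoc C β α).trans ((Equiv.refl C).sumCongr (Equiv.sumComm β α))
  have hreorder (x : α → 𝕄) :
      Sum.elim ((↑) : C → 𝕄) (Sum.elim x e) ∘ reorder = Sum.elim (Sum.elim (↑) e) x := by
    ext ((c | b) | a) <;> rfl
  constructor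
  · rintro ⟨φ, rfl⟩
    refine ⟨_, ⟨φ.relabel reorder, rfl⟩, ?_⟩
    simp only [mem_ofPred_eq, Formula.realize_relabel, hreorder]
  · rintro ⟨_, ⟨φ, rfl⟩, rfl⟩
    refine ⟨φ.relabel reorder.symm, ?_⟩
    simp only [mem_ofPred_eq, Formula.realize_relabel, ← hreorder, Function.comp_assoc,
      Equiv.self_comp_symm, Function.comp_id]

theorem definable_union_range_of_definable {T : Set (α ⊕ β → 𝕄)} (hT : C.Definable L T)
    (e : β → 𝕄) : (C ∪ range e).Definable L {x : α → 𝕄 | Sum.elim x e ∈ T} :=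
  definable_union_range_iff.2 ⟨T, hT, rfl⟩

theorem mem_iff_of_definable_of_fixing {S : Set (α → 𝕄)} (hS : C.Definable L S) (σ : 𝕄 ≃[L] 𝕄)
    (hσ : ∀ c ∈ C, σ c = c) (x : α → 𝕄) : σ ∘ x ∈ S ↔ x ∈ S := by
  obtain ⟨φ, rfl⟩ := definable_iff_exists_formula_sum.1 hS
  have hfix : σ ∘ Sum.elim ((↑) : C → 𝕄) x = Sum.elim (↑) (σ ∘ x) := by
    ext (c | i)
    · exact hσ c c.2
    · rfl
  rw [mem_ofPred_eq, mem_ofPred_eq, ← hfix, StrongHomClass.realize_formula]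

theorem symm_apply_eq_of_fixing {σ : 𝕄 ≃[L] 𝕄} (hσ : ∀ c ∈ C, σ c = c) :
    ∀ c ∈ C, σ.symm c = c := by
  intro c hc
  conv_lhs => rw [← hσ c hc]
  exact σ.symm_apply_apply c

theorem image_eq_of_fixing {σ : 𝕄 ≃[L] 𝕄} (hσ : ∀ c ∈ C, σ c = c) : σ '' C = C :=
  (image_congr hσ).trans (image_id' C)

theorem exists_mem_elementarySubstructure {M : L.ElementarySubstructure 𝕄} [Finite α]
    {S : Set (α → 𝕄)} (hS : (M : Set 𝕄).Definable L S) (hne : S.Nonempty) :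
    ∃ x ∈ S, ∀ i, x i ∈ M := by
  obtain ⟨φ, rfl⟩ := definable_iff_exists_formula_sum.1 hS
  have hexists : (φ.iExs α).Realize (M.subtype ∘ id) := Formula.realize_iExs.2 hne
  rw [M.subtype.map_formula, Formula.realize_iExs] at hexists
  obtain ⟨y, hy⟩ := hexists
  refine ⟨M.subtype ∘ y, ?_, fun i => (y i).2⟩
  rw [← M.subtype.map_formula, Sum.comp_elim] at hy
  exact hy

end Definable

section TypeOver

variable {L : FirstOrder.Language.{u, v}} {𝕄 : Type w} [L.Structure 𝕄]
  {α : Type x} {β : Type y} {C D : Set 𝕄}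

variable (L) in
/-- The type over `C` of a filter `F` of tuples, encoded as the filter generated by the
`C`-definable sets in `F`. For `F = pure x` this is `tp(x/C)`; for an ultrafilter `F` it is the
restriction to `C` of the global type of `F`, and a tuple `x` realizes it when
`typeOver L C (pure x) = typeOver L C F`. -/
def typeOver (C : Set 𝕄) (F : Filter (α → 𝕄)) : Filter (α → 𝕄) where
  sets := {S | ∃ T ∈ F, C.Definable L T ∧ T ⊆ S}
  univ_sets := ⟨univ, univ_mem, Set.definable_univ, Subset.rfl⟩
  sets_of_superset := fun ⟨T, hT, hdef, hTS⟩ hSS' => ⟨T, hT, hdef, hTS.trans hSS'⟩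
  inter_sets := fun ⟨T, hT, hdef, hTS⟩ ⟨T', hT', hdef', hTS'⟩ =>
    ⟨T ∩ T', inter_mem hT hT', hdef.inter hdef', inter_subset_inter hTS hTS'⟩

theorem mem_typeOver {F : Filter (α → 𝕄)} {S : Set (α → 𝕄)} :
    S ∈ typeOver L C F ↔ ∃ T ∈ F, C.Definable L T ∧ T ⊆ S :=
  Iff.rfl

theorem mem_typeOver_of_definable {F : Filter (α → 𝕄)} {S : Set (α → 𝕄)}
    (hS : C.Definable L S) : S ∈ typeOver L C F ↔ S ∈ F :=
  ⟨fun ⟨_, hT, _, hTS⟩ => mem_of_superset hT hTS, fun h => ⟨S, h, hS, Subset.rfl⟩⟩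

theorem le_typeOver (F : Filter (α → 𝕄)) : F ≤ typeOver L C F :=
  fun _ ⟨_, hT, _, hTS⟩ => mem_of_superset hT hTS

theorem typeOver_eq_iff {F G : Filter (α → 𝕄)} :
    typeOver L C F = typeOver L C G ↔ ∀ S, C.Definable L S → (S ∈ F ↔ S ∈ G) := by
  constructor
  · intro h S hS
    rw [← mem_typeOver_of_definable hS, h, mem_typeOver_of_definable hS]
  · intro h
    ext S
    simp only [mem_typeOver]
    exact exists_congr fun T => ⟨fun ⟨hT, hdef, hTS⟩ => ⟨(h T hdef).1 hT, hdef, hTS⟩,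
      fun ⟨hT, hdef, hTS⟩ => ⟨(h T hdef).2 hT, hdef, hTS⟩⟩

theorem typeOver_eq_iff_le {F : Filter (α → 𝕄)} [F.NeBot] {U : Ultrafilter (α → 𝕄)} :
    typeOver L C F = typeOver L C (U : Filter (α → 𝕄)) ↔
      F ≤ typeOver L C (U : Filter (α → 𝕄)) := by
  refine ⟨fun h => (le_typeOver F).trans h.le, fun h => typeOver_eq_iff.2 fun S hS => ?_⟩
  refine ⟨fun hF => ?_, fun hU => h ((mem_typeOver_of_definable hS).2 hU)⟩
  by_contra hU
  have hcompl : Sᶜ ∈ F :=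
    h ((mem_typeOver_of_definable hS.compl).2 (Ultrafilter.compl_mem_iff_notMem.2 hU))
  exact F.empty_notMem (inter_compl_self S ▸ inter_mem hF hcompl)

theorem typeOver_eq_of_subset {F G : Filter (α → 𝕄)} (hDC : D ⊆ C)
    (h : typeOver L C F = typeOver L C G) : typeOver L D F = typeOver L D G :=
  typeOver_eq_iff.2 fun S hS => typeOver_eq_iff.1 h S (hS.mono hDC)

theorem typeOver_map {F G : Filter (α → 𝕄)} (h : typeOver L C F = typeOver L C G) (f : β → α) :
    typeOver L C (F.map (· ∘ f)) = typeOver L C (G.map (· ∘ f)) :=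
  typeOver_eq_iff.2 fun _ hS => typeOver_eq_iff.1 h _ (hS.preimage_comp f)

theorem sameType_iff_definable {a a' : α → 𝕄} :
    SameType L C a a' ↔ ∀ S : Set (α → 𝕄), C.Definable L S → (a ∈ S ↔ a' ∈ S) :=
  ⟨fun h _ ⟨φ, hφ⟩ => hφ ▸ h φ, fun h φ => h _ ⟨φ, rfl⟩⟩

theorem sameType_iff_typeOver_eq {a a' : α → 𝕄} :
    SameType L C a a' ↔
      typeOver L C (pure a : Filter (α → 𝕄)) = typeOver L C (pure a' : Filter (α → 𝕄)) := by
  simp only [sameType_iff_definable, typeOver_eq_iff, mem_pure]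

theorem SameType.mono {a a' : α → 𝕄} (h : SameType L C a a') (hDC : D ⊆ C) :
    SameType L D a a' :=
  sameType_iff_definable.2 fun S hS => sameType_iff_definable.1 h S (hS.mono hDC)

theorem SameType.comp {a a' : α → 𝕄} (h : SameType L C a a') (f : β → α) :
    SameType L C (a ∘ f) (a' ∘ f) :=
  sameType_iff_definable.2 fun _ hS => sameType_iff_definable.1 h _ (hS.preimage_comp f)

theorem SameType.symm {a a' : α → 𝕄} (h : SameType L C a a') : SameType L C a' a :=
  fun φ => (h φ).symm

theorem SameType.trans {a a' a'' : α → 𝕄} (h : SameType L C a a') (h' : SameType L C a' a'') :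
    SameType L C a a'' :=
  fun φ => (h φ).trans (h' φ)

theorem sameType_union_range_iff {a a' : α → 𝕄} {e : β → 𝕄} :
    SameType L (C ∪ range e) a a' ↔ SameType L C (Sum.elim a e) (Sum.elim a' e) := by
  simp only [sameType_iff_definable]
  refine ⟨fun h S hS => h _ (definable_union_range_of_definable hS e), fun h S hS => ?_⟩
  obtain ⟨T, hT, rfl⟩ := definable_union_range_iff.1 hS
  exact h T hT

theorem sameType_of_fixing {σ : 𝕄 ≃[L] 𝕄} (hσ : ∀ c ∈ C, σ c = c) (x : α → 𝕄) :
    SameType L C x (σ ∘ x) :=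
  sameType_iff_definable.2 fun _ hS => (mem_iff_of_definable_of_fixing hS σ hσ x).symm

end TypeOver

theorem exists_ultrafilter_forall_mem {I : Type x} {X : Type y} {S : I → Set X}
    (h : ∀ t : Finset I, ∃ a, ∀ i ∈ t, a ∈ S i) : ∃ Q : Ultrafilter X, ∀ i, S i ∈ Q := by
  have hneBot : (⨅ i, 𝓟 (S i)).NeBot :=
    (hasBasis_iInf_principal_finite S).neBot_iff.2 fun {t} ht => by
      obtain ⟨a, ha⟩ := h ht.toFinset
      exact ⟨a, mem_iInter₂.2 fun i hi => ha i (ht.mem_toFinset.2 hi)⟩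
  exact ⟨Ultrafilter.of _, fun i =>
    Ultrafilter.of_le _ (mem_iInf_of_mem i (mem_principal_self _))⟩

section Monster

variable {L : FirstOrder.Language.{u, v}} {𝕄 : Type w} [L.Structure 𝕄]
  {κ : Cardinal.{w}} {α : Type x} {β : Type y} {C : Set 𝕄}

theorem IsMonster.aleph0_lt (h : IsMonster L 𝕄 κ) : ℵ₀ < κ := by
  have haleph0_le : ℵ₀ ≤ Cardinal.lift.{w} (Order.succ (theoryCard L)) :=
    aleph0_le_lift.2 ((le_max_left _ _).trans (Order.le_succ _))
  exact aleph0_lt_lift.1 (haleph0_le.trans_lt h.card_lt)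

theorem IsMonster.card_union_lt (h : IsMonster L 𝕄 κ) {A B : Set 𝕄} (hA : #A < κ) (hB : #B < κ) :
    #(A ∪ B : Set 𝕄) < κ :=
  (mk_union_le A B).trans_lt (add_lt_of_lt h.aleph0_lt.le hA hB)

theorem IsMonster.card_lt_of_finite (h : IsMonster L 𝕄 κ) {A : Set 𝕄} (hA : A.Finite) : #A < κ :=
  (lt_aleph0_iff_set_finite.2 hA).trans h.aleph0_lt

theorem IsMonster.exists_realizes (h : IsMonster L 𝕄 κ) [Finite α] (hC : #C < κ)
    (U : Ultrafilter (α → 𝕄)) :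
    ∃ x : α → 𝕄, typeOver L C (pure x : Filter (α → 𝕄)) = typeOver L C (U : Filter (α → 𝕄)) := by
  obtain ⟨n, ⟨e⟩⟩ := Finite.exists_equiv_fin α
  obtain ⟨a, ha⟩ := h.saturated C hC n
    {φ | ∀ᶠ v in (U : Filter (α → 𝕄)), φ.Realize (v ∘ e.symm)} (by
      intro s hs
      obtain ⟨v, hv⟩ := ((eventually_all_finset s).2 fun φ hφ => hs hφ).exists
      exact ⟨v ∘ e.symm, hv⟩)
  refine ⟨a ∘ e, typeOver_eq_iff_le.2 (pure_le_iff.2 ?_)⟩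
  rintro _ ⟨_, hφU, ⟨φ, rfl⟩, hsub⟩
  have hφa : (φ.relabel e).Realize a := by
    refine ha _ (mem_of_superset hφU fun v hv => ?_)
    rw [mem_ofPred_eq, Formula.realize_relabel, Function.comp_assoc, e.symm_comp_self,
      Function.comp_id]
    exact hv
  exact hsub (Formula.realize_relabel.1 hφa)

theorem IsMonster.exists_equiv_of_realize_iff (h : IsMonster L 𝕄 κ) {w w' : β → 𝕄}
    (hw : #(range w) < κ) (hww' : ∀ φ : L.Formula β, φ.Realize w ↔ φ.Realize w') :
    ∃ σ : 𝕄 ≃[L] 𝕄, σ ∘ w = w' := by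
  obtain ⟨σ, hσ⟩ := h.homogeneous (range w) hw (w' ∘ rangeSplitting w) fun φ => by
    rw [← Formula.realize_relabel, ← hww', Formula.realize_relabel, comp_rangeSplitting]
  refine ⟨σ, funext fun b => ?_⟩
  have heq := hww' (Term.equal (Term.var (rangeSplitting w ⟨w b, b, rfl⟩)) (Term.var b))
  simp only [Formula.realize_equal, Term.realize_var, apply_rangeSplitting, true_iff] at heq
  exact (hσ ⟨w b, b, rfl⟩).trans heq

theorem IsMonster.exists_equiv (h : IsMonster L 𝕄 κ) [Finite α] (hC : #C < κ) {a a' : α → 𝕄}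
    (haa' : SameType L C a a') : ∃ σ : 𝕄 ≃[L] 𝕄, (∀ c ∈ C, σ c = c) ∧ σ ∘ a = a' := by
  obtain ⟨σ, hσ⟩ := h.exists_equiv_of_realize_iff (w := Sum.elim ((↑) : C → 𝕄) a)
    (w' := Sum.elim ((↑) : C → 𝕄) a')
    (by
      rw [Sum.elim_range, Subtype.range_coe]
      exact h.card_union_lt hC (h.card_lt_of_finite (finite_range a)))
    fun φ => sameType_iff_definable.1 haa' {v | φ.Realize (Sum.elim ((↑) : C → 𝕄) v)}
      (definable_iff_exists_formula_sum.2 ⟨φ, rfl⟩)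
  exact ⟨σ, fun c hc => congrFun hσ (Sum.inl ⟨c, hc⟩), funext fun i => congrFun hσ (Sum.inr i)⟩

end Monster

section GlobalTypes

variable {L : FirstOrder.Language.{u, v}} {𝕄 : Type w} [L.Structure 𝕄] {ι : Type w'}

/-- The global type `q` is the type of the ultrafilter `Q` on tuples: it consists of the formulas
that hold `Q`-almost everywhere. -/
def IsTypeOfUltrafilter (q : GlobalType L 𝕄 ι) (Q : Ultrafilter (ι → 𝕄)) : Prop :=
  ∀ φ : L[[𝕄]].Formula ι, q.Contains φ ↔ ∀ᶠ x in (Q : Filter (ι → 𝕄)), φ.Realize x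

theorem exists_globalType_isTypeOfUltrafilter [Nonempty 𝕄] (Q : Ultrafilter (ι → 𝕄)) :
    ∃ q : GlobalType L 𝕄 ι, IsTypeOfUltrafilter q Q := by
  let T : L[[𝕄]][[ι]].Theory :=
    {ψ | ∀ᶠ x in (Q : Filter (ι → 𝕄)), ψ ∈ (L.elementaryDiagram 𝕄).typeOf x}
  refine ⟨⟨T, fun ψ hψ => Eventually.of_forall fun x => Theory.CompleteType.subset _ hψ, ?_, ?_⟩,
    fun φ => ?_⟩
  · refine Theory.isSatisfiable_iff_isFinitelySatisfiable.2 fun T₀ hT₀ => ?_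
    obtain ⟨x, hx⟩ := ((eventually_all_finset T₀).2 fun ψ hψ => hT₀ hψ).exists
    exact ((L.elementaryDiagram 𝕄).typeOf x).isMaximal.1.mono hx
  · exact fun ψ => Ultrafilter.eventually_or.1 <|
      Eventually.of_forall fun x => Theory.CompleteType.mem_or_not_mem _ ψ
  · exact eventually_congr (Eventually.of_forall fun x => Theory.CompleteType.formula_mem_typeOf)

theorem GlobalType.contains_not (q : GlobalType L 𝕄 ι) (φ : L[[𝕄]].Formula ι) :
    q.Contains φ.not ↔ ¬ q.Contains φ := by
  rw [GlobalType.Contains, Formula.equivSentence_not]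
  exact q.not_mem_iff _

theorem GlobalType.exists_realize [Finite ι] (q : GlobalType L 𝕄 ι)
    (s : Finset (L[[𝕄]].Formula ι)) (hs : ∀ φ ∈ s, q.Contains φ) :
    ∃ x : ι → 𝕄, ∀ φ ∈ s, φ.Realize x := by
  obtain ⟨N, x, rfl⟩ := Theory.exists_modelType_is_realized_in _ q
  let τ : L[[𝕄]].Sentence :=
    ((Formula.iInf fun φ : s => (φ : L[[𝕄]].Formula ι)).relabel
      (Sum.inr : ι → Empty ⊕ ι)).iExs ι
  have hN : N ⊨ τ := by
    simp only [τ, Sentence.Realize, Formula.realize_iExs, Formula.realize_relabel,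
      Formula.realize_iInf, Sum.elim_comp_inr]
    exact ⟨x, fun φ => Theory.CompleteType.formula_mem_typeOf.1 (hs φ φ.2)⟩
  have h𝕄 : 𝕄 ⊨ τ := by
    by_contra hτ
    exact Theory.realize_sentence_of_mem (M := N) (L.elementaryDiagram 𝕄) (φ := τ.not) hτ hN
  simp only [τ, Sentence.Realize, Formula.realize_iExs, Formula.realize_relabel,
    Formula.realize_iInf, Sum.elim_comp_inr, Subtype.forall] at h𝕄
  exact h𝕄

theorem GlobalType.exists_isTypeOfUltrafilter [Finite ι] (q : GlobalType L 𝕄 ι) :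
    ∃ Q : Ultrafilter (ι → 𝕄), IsTypeOfUltrafilter q Q := by
  obtain ⟨Q, hQ⟩ := exists_ultrafilter_forall_mem
    (S := fun φ : {φ // q.Contains φ} => Set.ofPred φ.1.Realize) fun t => by
      obtain ⟨x, hx⟩ := q.exists_realize (t.map (Function.Embedding.subtype _))
        fun φ hφ => by
          obtain ⟨ψ, -, rfl⟩ := Finset.mem_map.1 hφ
          exact ψ.2
      exact ⟨x, fun φ hφ => hx φ (Finset.mem_map_of_mem _ hφ)⟩
  refine ⟨Q, fun φ => ⟨fun hφ => hQ ⟨φ, hφ⟩, fun hφ => ?_⟩⟩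
  by_contra hnot
  exact Ultrafilter.eventually_not.1 (hQ ⟨φ.not, (q.contains_not φ).2 hnot⟩) hφ

theorem realize_lhomWithConstantsMap_val {C : Set 𝕄} (φ : L[[C]].Formula ι) (x : ι → 𝕄) :
    ((L.lhomWithConstantsMap (Subtype.val : C → 𝕄)).onFormula φ).Realize x ↔ φ.Realize x :=
  have : (LHom.constantsOnMap (Subtype.val : C → 𝕄)).IsExpansionOn 𝕄 :=
    constantsOnMap_isExpansionOn rfl
  have : (L.lhomWithConstantsMap (Subtype.val : C → 𝕄)).IsExpansionOn 𝕄 :=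
    LHom.sumMap_isExpansionOn _ _ _
  LHom.realize_onFormula _ φ

theorem realize_lhomWithConstantsMap_equiv {N : Type x} [L.Structure N] (e : 𝕄 ≃[L] N)
    (φ : L[[𝕄]].Formula ι) (x : ι → 𝕄) :
    ((L.lhomWithConstantsMap e).onFormula φ).Realize (e ∘ x) ↔ φ.Realize x := by
  let : (constantsOn 𝕄).Structure N := constantsOn.structure e
  have : (LHom.constantsOnMap e).IsExpansionOn N := constantsOnMap_isExpansionOn rfl
  have : (L.lhomWithConstantsMap e).IsExpansionOn N := LHom.sumMap_isExpansionOn _ _ _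
  have hcomp : Sum.elim (fun c : 𝕄 => (L.con c : N)) (e ∘ x) = e ∘ Sum.elim (L.con ·) x := by
    ext (c | i) <;> rfl
  rw [LHom.realize_onFormula, Formula.Realize, ← BoundedFormula.realize_constantsVarsEquiv, hcomp,
    ← Formula.Realize, StrongHomClass.realize_formula, Formula.Realize,
    BoundedFormula.realize_constantsVarsEquiv, Formula.Realize]

theorem IsTypeOfUltrafilter.isInvariant_iff {q : GlobalType L 𝕄 ι}
    {Q : Ultrafilter (ι → 𝕄)} (h : IsTypeOfUltrafilter q Q) {C : Set 𝕄} :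
    q.IsInvariant C ↔ ∀ σ : 𝕄 ≃[L] 𝕄, (∀ c ∈ C, σ c = c) → ∀ φ : L[[𝕄]].Formula ι,
      ∀ᶠ x in (Q : Filter (ι → 𝕄)), (φ.Realize x ↔ φ.Realize (σ.symm ∘ x)) := by
  have realize_moved (σ : 𝕄 ≃[L] 𝕄) (φ : L[[𝕄]].Formula ι) (x : ι → 𝕄) :
      ((L.lhomWithConstantsMap σ).onFormula φ).Realize x ↔ φ.Realize (σ.symm ∘ x) := by
    rw [← realize_lhomWithConstantsMap_equiv σ φ, ← Function.comp_assoc]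
    congr!
    exact (funext fun i => σ.apply_symm_apply (x i)).symm
  simp only [GlobalType.IsInvariant, h _, realize_moved]
  refine forall₃_congr fun σ _ φ => ?_
  simp only [iff_iff_and_or_not_and_not, Ultrafilter.eventually_or, eventually_and,
    Ultrafilter.eventually_not]

theorem IsTypeOfUltrafilter.realizesRestrict_iff {q : GlobalType L 𝕄 ι}
    {Q : Ultrafilter (ι → 𝕄)} (h : IsTypeOfUltrafilter q Q) {C : Set 𝕄} {a : ι → 𝕄} :
    q.RealizesRestrict C a ↔
      typeOver L C (pure a : Filter (ι → 𝕄)) = typeOver L C (Q : Filter (ι → 𝕄)) := by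
  rw [typeOver_eq_iff_le, pure_le_iff]
  simp only [GlobalType.RealizesRestrict, h _, realize_lhomWithConstantsMap_val]
  constructor
  · rintro hφ _ ⟨_, hQ, ⟨φ, rfl⟩, hsub⟩
    exact hsub (hφ φ hQ)
  · exact fun hS φ hφ => hS _ ((mem_typeOver_of_definable ⟨φ, rfl⟩).2 hφ)

end GlobalTypes

section ErdosRado

variable {n : ℕ} {C K J : Type w} [LinearOrder K] [LinearOrder J]
  {f : (Fin (n + 1) → J) → C} {α α' : J} {e e' : K → J}

/-- The elements of `J` that may continue `e` at `k` in an end-homogeneous way: they lie above the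
earlier terms, and `f` does not distinguish them from `α` as a last coordinate after these. -/
def endHomogeneousCandidates (f : (Fin (n + 1) → J) → C) (α : J) (e : K → J) (k : K) : Set J :=
  {γ | (∀ k' < k, e k' < γ) ∧ ∀ u : Fin n → K, (∀ i, u i < k) →
    f (Fin.snoc (e ∘ u) γ) = f (Fin.snoc (e ∘ u) α)}

/-- The sequence `e` climbs to `α`, always choosing the least end-homogeneous continuation; once it
cannot go on below `α` it stays at `α`. -/
def IsEndHomogeneousPath (f : (Fin (n + 1) → J) → C) (α : J) (e : K → J) : Prop :=
  ∀ k, IsLeast (insert α (endHomogeneousCandidates f α e k)) (e k)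

theorem endHomogeneousCandidates_congr {k : K} (he : ∀ k' < k, e k' = e' k')
    (hf : ∀ u : Fin n → K, f (Fin.snoc (e ∘ u) α) = f (Fin.snoc (e' ∘ u) α')) :
    endHomogeneousCandidates f α e k = endHomogeneousCandidates f α' e' k := by
  ext γ
  refine and_congr (forall₂_congr fun k' hk' => by rw [he k' hk']) (forall₂_congr fun u hu => ?_)
  rw [hf u, show e ∘ u = e' ∘ u from funext fun i => he _ (hu i)]

theorem IsEndHomogeneousPath.mem_candidates (he : IsEndHomogeneousPath f α e) {k : K}
    (hk : ∀ k' < k, e k' ≠ α) :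
    e k ∈ endHomogeneousCandidates f α e k := by
  rcases (he k).1 with hα | hmem
  · exact ⟨fun k' hk' => hα ▸ lt_of_le_of_ne ((he k').2 (mem_insert _ _)) (hk k' hk'),
      fun u _ => by rw [hα]⟩
  · exact hmem

variable [WellFoundedLT K]

theorem IsEndHomogeneousPath.eq_of_forall_eq (he : IsEndHomogeneousPath f α e)
    (he' : IsEndHomogeneousPath f α' e')
    (hf : ∀ u : Fin n → K, f (Fin.snoc (e ∘ u) α) = f (Fin.snoc (e' ∘ u) α')) {k₀ : K}
    (hk₀ : ∀ k < k₀, e k ≠ α) (hk₀' : ∀ k < k₀, e' k ≠ α') : ∀ k ≤ k₀, e k = e' k := by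
  intro k
  induction k using WellFoundedLT.induction with
  | _ k ih =>
    intro hk
    have hcandidates := endHomogeneousCandidates_congr
      (fun k' hk' => ih k' hk' (hk'.le.trans hk)) hf
    have hmem := he.mem_candidates fun k' hk' => hk₀ k' (hk'.trans_le hk)
    have hmem' := he'.mem_candidates fun k' hk' => hk₀' k' (hk'.trans_le hk)
    exact le_antisymm ((he k).2 (mem_insert_of_mem _ (hcandidates ▸ hmem')))
      ((he' k).2 (mem_insert_of_mem _ (hcandidates ▸ hmem)))

variable [WellFoundedLT J]

theorem exists_isEndHomogeneousPath (f : (Fin (n + 1) → J) → C) (α : J) :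
    ∃ e : K → J, IsEndHomogeneousPath f α e := by
  let candidates (k : K) (before : (k' : K) → k' < k → J) : Set J :=
    insert α {γ | (∀ k' (h : k' < k), before k' h < γ) ∧ ∀ (u : Fin n → K) (hu : ∀ i, u i < k),
      f (Fin.snoc (fun i => before (u i) (hu i)) γ) =
        f (Fin.snoc (fun i => before (u i) (hu i)) α)}
  have hne (k before) : (candidates k before).Nonempty := ⟨α, mem_insert _ _⟩
  have wfK : WellFounded ((· < ·) : K → K → Prop) := wellFounded_lt
  have wfJ : WellFounded ((· < ·) : J → J → Prop) := wellFounded_lt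
  let e : K → J := wfK.fix fun k before => wfJ.min (candidates k before) (hne k before)
  refine ⟨e, fun k => ?_⟩
  have he : e k = wfJ.min (candidates k fun k' _ => e k') (hne k _) := wfK.fix_eq _ k
  rw [he]
  exact ⟨wfJ.min_mem _ _, fun γ hγ => not_lt.1 (wfJ.not_lt_min _ hγ)⟩

theorem exists_isEndHomogeneousPath_forall_ne (hJ : #(K × ((Fin n → K) → C)) < #J)
    (f : (Fin (n + 1) → J) → C) :
    ∃ (α : J) (e : K → J), IsEndHomogeneousPath f α e ∧ ∀ k, e k ≠ α := by
  choose e he using exists_isEndHomogeneousPath (K := K) f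
  by_contra! hreach
  have hfirst (α : J) : ∃ k, e α k = α ∧ ∀ k' < k, e α k' ≠ α := by
    obtain ⟨k, hk, hmin⟩ := wellFounded_lt.has_min {k | e α k = α} (hreach α _ (he α))
    exact ⟨k, hk, fun k' hk' h => hmin k' h hk'⟩
  choose k₀ hk₀ hlt using hfirst
  -- An element of `J` is determined by the length of its path and the colours seen on the way.
  let code (α : J) : K × ((Fin n → K) → C) := (k₀ α, fun u => f (Fin.snoc (e α ∘ u) α))
  have hcode : Function.Injective code := by
    intro α α' h
    obtain ⟨hk, hf⟩ := Prod.ext_iff.1 h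
    change k₀ α = k₀ α' at hk
    rw [← hk₀ α, ← hk₀ α', ← hk]
    exact (he α).eq_of_forall_eq (he α') (congrFun hf) (hlt α) (hk ▸ hlt α') _ le_rfl
  exact (mk_le_of_injective hcode).not_gt hJ

theorem exists_endHomogeneous (n : ℕ) (C K : Type w) [LinearOrder K] [WellFoundedLT K] :
    ∃ (J : Type w) (_ : LinearOrder J) (_ : WellFoundedLT J), ∀ f : (Fin (n + 1) → J) → C,
      ∃ h : K → J, StrictMono h ∧ ∃ g : (Fin n → K) → C, ∀ (u : Fin n → K) (k : K),
        (∀ i, u i < k) → f (Fin.snoc (h ∘ u) (h k)) = g u := by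
  let c : Cardinal.{w} := Order.succ #(K × ((Fin n → K) → C))
  refine ⟨c.ord.ToType, inferInstance, inferInstance, fun f => ?_⟩
  obtain ⟨α, e, he, hne⟩ := exists_isEndHomogeneousPath_forall_ne
    ((Order.lt_succ _).trans_eq (mk_ord_toType c).symm) f
  have hmem (k : K) := he.mem_candidates (k := k) fun k' _ => hne k'
  exact ⟨e, fun k' k hk => (hmem k).1 k' hk, fun u => f (Fin.snoc (e ∘ u) α),
    fun u k hu => (hmem k).2 u hu⟩

/-- The Erdős–Rado theorem without explicit bounds. -/
theorem exists_homogeneous (n : ℕ) (C K : Type w) [LinearOrder K] [WellFoundedLT K] :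
    ∃ (J : Type w) (_ : LinearOrder J) (_ : WellFoundedLT J), ∀ f : (Fin n → J) → C,
      ∃ h : K → J, StrictMono h ∧ ∃ c : C, ∀ u : Fin n → K, StrictMono u → f (h ∘ u) = c := by
  induction n generalizing K with
  | zero =>
    exact ⟨K, inferInstance, inferInstance, fun f => ⟨id, strictMono_id, f finZeroElim,
      fun _ _ => congrArg f (Subsingleton.elim _ _)⟩⟩
  | succ n ih =>
    obtain ⟨J₁, _, _, hJ₁⟩ := ih K
    obtain ⟨J, hlinear, hwf, hJ⟩ := exists_endHomogeneous n C J₁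
    refine ⟨J, hlinear, hwf, fun f => ?_⟩
    obtain ⟨h, hmono, g, hg⟩ := hJ f
    obtain ⟨h', hmono', c, hc⟩ := hJ₁ g
    refine ⟨h ∘ h', hmono.comp hmono', c, fun u hu => ?_⟩
    have hsnoc : (h ∘ h') ∘ u = Fin.snoc (h ∘ h' ∘ Fin.init u) (h (h' (u (Fin.last n)))) := by
      rw [Fin.comp_init, Fin.comp_init]
      exact (Fin.snoc_init_self _).symm
    rw [hsnoc, hg (h' ∘ Fin.init u) _ fun i => hmono' (hu (Fin.castSucc_lt_last i))]
    exact hc _ (hu.comp Fin.strictMono_castSucc)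

end ErdosRado

section Freeness

variable {L : FirstOrder.Language.{u, v}} {𝕄 : Type w} [L.Structure 𝕄] {D : Set 𝕄}
  {κ : Cardinal.{w}} {ι : Type w'} {β : Type y} {γ : Type x}

theorem typeOver_eq_of_eventually {F : Filter (γ → 𝕄)} [F.NeBot] {U : Ultrafilter (γ → 𝕄)}
    (h : ∀ᶠ v in F, typeOver L D (pure v : Filter (γ → 𝕄)) = typeOver L D (U : Filter (γ → 𝕄))) :
    typeOver L D F = typeOver L D (U : Filter (γ → 𝕄)) :=
  typeOver_eq_iff_le.2 fun _ hS => h.mono fun v hv => le_typeOver (pure v) (hv ▸ hS)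

variable (L D) in
/-- The properties that an independence relation gives, over a fixed small model `D`, to the
relation `R b B` between tuples `b` and finite sets `B`. -/
structure IsFreeness (R : (ι → 𝕄) → Set 𝕄 → Prop) : Prop where
  invariant : ∀ σ : 𝕄 ≃[L] 𝕄, (∀ c ∈ D, σ c = c) → ∀ b B, B.Finite → R b B → R (σ ∘ b) (σ '' B)
  mono : ∀ b B B', B.Finite → R b B → B' ⊆ B → R b B'
  strongFiniteCharacter : ∀ b B, B.Finite → ¬ R b B →
    ∃ S, (D ∪ B).Definable L S ∧ b ∈ S ∧ ∀ b' ∈ S, ¬ R b' B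
  extension : ∀ b B B', B'.Finite → R b B → B ⊆ B' → ∃ b', SameType L (D ∪ B) b b' ∧ R b' B'

variable {R : (ι → 𝕄) → Set 𝕄 → Prop}

/-- Strong finite character makes freeness from a tuple closed among the tuples in a fixed type;
without the condition on `v ∘ g` this fails. -/
theorem IsFreeness.of_eventually (hR : IsFreeness L D R) (h : IsMonster L 𝕄 κ) (hD : #D < κ)
    [Finite β] {F : Filter (γ → 𝕄)} [F.NeBot] {x : γ → 𝕄}
    (hx : typeOver L D (pure x : Filter (γ → 𝕄)) = typeOver L D F) (f : ι → γ) (g : β → γ)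
    (hF : ∀ᶠ v in F, SameType L D (v ∘ g) (x ∘ g) ∧ R (v ∘ f) (range (v ∘ g))) :
    R (x ∘ f) (range (x ∘ g)) := by
  by_contra hnot
  obtain ⟨S, hS, hxS, hdependent⟩ := hR.strongFiniteCharacter _ _ (finite_range _) hnot
  obtain ⟨T, hT, rfl⟩ := definable_union_range_iff.1 hS
  rw [mem_ofPred_eq, ← Sum.comp_elim] at hxS
  have hTF : ∀ᶠ v in F, v ∘ Sum.elim f g ∈ T :=
    (typeOver_eq_iff.1 hx _ (hT.preimage_comp (Sum.elim f g))).1 hxS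
  obtain ⟨v, hvT, hvx, hvR⟩ := (hTF.and hF).exists
  obtain ⟨σ, hσ, hσv⟩ := h.exists_equiv hD hvx
  have hσR := hR.invariant σ hσ _ _ (finite_range _) hvR
  rw [← range_comp, hσv] at hσR
  refine hdependent _ ?_ hσR
  rw [mem_ofPred_eq, ← hσv, ← Sum.comp_elim, mem_iff_of_definable_of_fixing hT σ hσ,
    ← Sum.comp_elim]
  exact hvT

end Freeness

section TypeAt

variable {L : FirstOrder.Language.{u, v}} {𝕄 : Type w} [L.Structure 𝕄] {D : Set 𝕄}
  {ι : Type w'} {β : Type y} {γ : Type*} {J : Type x} {U U' U'' : Ultrafilter (J × ι → 𝕄)}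
  {I I' : Set J}

variable (L D) in
/-- The type over `D` of the tuples at the indices `u` in a `U`-generic family of tuples indexed by
`J`. Such an ultrafilter plays the role of a family of tuples that may be too long to exist in the
monster model. -/
def typeAt (U : Ultrafilter (J × ι → 𝕄)) (u : β → J) : Filter (β × ι → 𝕄) :=
  typeOver L D ((U : Filter (J × ι → 𝕄)).map (· ∘ Prod.map u id))

theorem typeAt_comp_congr {u : β → J} (h : typeAt L D U u = typeAt L D U' u) (f : γ → β) :
    typeAt L D U (u ∘ f) = typeAt L D U' (u ∘ f) :=
  typeOver_map h (Prod.map f id)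

variable (L D) in
/-- Finitely many tuples with indices in `I` have the same type over `D` in `U` and in `U'`. -/
def AgreeOn (I : Set J) (U U' : Ultrafilter (J × ι → 𝕄)) : Prop :=
  ∀ G : Finset J, (G : Set J) ⊆ I → typeAt L D U ((↑) : G → J) = typeAt L D U' ((↑) : G → J)

namespace AgreeOn

theorem typeAt_eq [Finite β] (h : AgreeOn L D I U U') {u : β → J} (hu : ∀ i, u i ∈ I) :
    typeAt L D U u = typeAt L D U' u :=
  typeAt_comp_congr (h (finite_range u).toFinset (by
    rw [Finite.coe_toFinset]
    exact range_subset_iff.2 hu)) fun i => ⟨u i, (finite_range u).mem_toFinset.2 ⟨i, rfl⟩⟩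

theorem refl (I : Set J) (U : Ultrafilter (J × ι → 𝕄)) : AgreeOn L D I U U :=
  fun _ _ => rfl

theorem trans (h : AgreeOn L D I U U') (h' : AgreeOn L D I U' U'') : AgreeOn L D I U U'' :=
  fun G hG => (h G hG).trans (h' G hG)

theorem mono (h : AgreeOn L D I U U') (hI : I' ⊆ I) : AgreeOn L D I' U U' :=
  fun G hG => h G (hG.trans hI)

end AgreeOn

variable (L D) in
/-- The filter of families of tuples that look like `U` at the indices in `I`; the ultrafilters
below it are those that agree with `U` on `I`. -/
def agreeFilter (I : Set J) (U : Ultrafilter (J × ι → 𝕄)) : Filter (J × ι → 𝕄) :=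
  ⨅ (G : Finset J) (_ : (G : Set J) ⊆ I),
    (typeAt L D U ((↑) : G → J)).comap (· ∘ Prod.map (↑) id)

theorem le_agreeFilter_iff : (U' : Filter (J × ι → 𝕄)) ≤ agreeFilter L D I U ↔
    AgreeOn L D I U U' := by
  simp only [agreeFilter, le_iInf_iff, ← map_le_iff_le_comap, AgreeOn]
  refine forall₂_congr fun G _ => ?_
  rw [eq_comm]
  exact (typeOver_eq_iff_le (U := U.map (· ∘ Prod.map ((↑) : G → J) id))).symm

theorem AgreeOn.agreeFilter_le (h : AgreeOn L D I U U') (hI : I ⊆ I') :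
    agreeFilter L D I' U' ≤ agreeFilter L D I U :=
  le_iInf₂ fun G hG => iInf₂_le_of_le G (hG.trans hI) (comap_mono (h G hG).ge)

theorem exists_comp_val_eq (G : Finset J) (x : G × ι → 𝕄) (b : ι → 𝕄) :
    ∃ v : J × ι → 𝕄, v ∘ Prod.map ((↑) : G → J) id = x ∧ ∀ j ∉ G, v ∘ Prod.mk j = b := by
  classical
  refine ⟨fun p => if hp : p.1 ∈ G then x (⟨p.1, hp⟩, p.2) else b p.2, ?_, fun j hj => ?_⟩
  · ext ⟨i, k⟩
    exact dif_pos i.2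
  · ext k
    exact dif_neg hj

end TypeAt

section FreeSequences

variable {L : FirstOrder.Language.{u, v}} {𝕄 : Type w} [L.Structure 𝕄] {D : Set 𝕄}
  {κ : Cardinal.{w}} {ι : Type w'} {R : (ι → 𝕄) → Set 𝕄 → Prop} {b : ι → 𝕄} {J : Type x}
  {U U' : Ultrafilter (J × ι → 𝕄)} {I : Set J}

variable (R) in
/-- The last tuple of a finite sequence is free from the previous ones. -/
def LastFree {n : ℕ} (x : Fin (n + 1) × ι → 𝕄) : Prop :=
  R (x ∘ Prod.mk (Fin.last n)) (range (x ∘ Prod.map Fin.castSucc id))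

variable (L D R b) in
/-- A `U`-generic family is a free sequence in `tp(b/D)` along `I`: each tuple has the type of `b`
over `D`, and the type over `D` of any finitely many tuples makes the last one free from the
previous ones. -/
structure IsFreeOn [Preorder J] (U : Ultrafilter (J × ι → 𝕄)) (I : Set J) : Prop where
  base : ∀ j ∈ I, typeOver L D ((U : Filter (J × ι → 𝕄)).map (· ∘ Prod.mk j)) =
    typeOver L D (pure b : Filter (ι → 𝕄))
  free : ∀ (n : ℕ) (u : Fin (n + 1) → J), StrictMono u → (∀ i, u i ∈ I) →
    ∀ x : Fin (n + 1) × ι → 𝕄,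
      typeOver L D (pure x : Filter (Fin (n + 1) × ι → 𝕄)) = typeAt L D U u → LastFree R x

theorem IsFreeOn.of_agreeOn [Preorder J] (hU : IsFreeOn L D R b U I) (h : AgreeOn L D I U U') :
    IsFreeOn L D R b U' I where
  base j hj := (typeOver_map (h.typeAt_eq (u := fun _ : Fin 1 => j) fun _ => hj)
    (Prod.mk 0)).symm.trans (hU.base j hj)
  free n u hu huI x hx := hU.free n u hu huI x (hx.trans (h.typeAt_eq huI).symm)

theorem IsFreeness.exists_family_free (hR : IsFreeness L D R) (h : IsMonster L 𝕄 κ) (hD : #D < κ)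
    [Finite ι] (hb : R b ∅) (U : Ultrafilter (J × ι → 𝕄)) {G : Finset J} {j : J} (hj : j ∉ G) :
    ∃ v : J × ι → 𝕄,
      typeOver L D (pure (v ∘ Prod.map ((↑) : G → J) id) : Filter (G × ι → 𝕄)) =
        typeAt L D U ((↑) : G → J) ∧
      SameType L D (v ∘ Prod.mk j) b ∧
      R (v ∘ Prod.mk j) (range (v ∘ Prod.map ((↑) : G → J) id)) := by
  obtain ⟨x, hx⟩ := h.exists_realizes hD (U.map (· ∘ Prod.map ((↑) : G → J) id))
  obtain ⟨b', hb', hRb'⟩ := hR.extension b ∅ (range x) (finite_range x) hb (empty_subset _)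
  obtain ⟨v, hvG, hv⟩ := exists_comp_val_eq G x b'
  refine ⟨v, ?_, ?_, ?_⟩
  · rwa [hvG]
  · rw [hv j hj]
    exact (hb'.mono subset_union_left).symm
  · rwa [hvG, hv j hj]

theorem IsFreeness.exists_agreeOn_eventually (hR : IsFreeness L D R) (h : IsMonster L 𝕄 κ)
    (hD : #D < κ) [Finite ι] (hb : R b ∅) (U : Ultrafilter (J × ι → 𝕄)) {j : J} (hj : j ∉ I) :
    ∃ U' : Ultrafilter (J × ι → 𝕄), AgreeOn L D I U U' ∧
      (∀ᶠ v in (U' : Filter (J × ι → 𝕄)), SameType L D (v ∘ Prod.mk j) b) ∧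
      ∀ (n : ℕ) (u : Fin n → J), (∀ i, u i ∈ I) → ∀ᶠ v in (U' : Filter (J × ι → 𝕄)),
        typeOver L D (pure (v ∘ Prod.map u id) : Filter (Fin n × ι → 𝕄)) = typeAt L D U' u ∧
        R (v ∘ Prod.mk j) (range (v ∘ Prod.map u id)) := by
  classical
  let E (G : Finset J) : Set (J × ι → 𝕄) := {v |
    typeOver L D (pure (v ∘ Prod.map ((↑) : G → J) id) : Filter (G × ι → 𝕄)) =
      typeAt L D U ((↑) : G → J) ∧
    SameType L D (v ∘ Prod.mk j) b ∧ R (v ∘ Prod.mk j) (range (v ∘ Prod.map ((↑) : G → J) id))}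
  have hE_anti : Antitone E := fun G G' hG v hv =>
    ⟨typeOver_map hv.1 (Prod.map (inclusion (Finset.coe_subset.2 hG)) id), hv.2.1,
      hR.mono _ _ _ (finite_range _) hv.2.2
        (range_comp_subset_range (Prod.map (inclusion (Finset.coe_subset.2 hG)) id)
          (v ∘ Prod.map ((↑) : G' → J) id))⟩
  obtain ⟨U', hU'⟩ := exists_ultrafilter_forall_mem
    (S := fun G : {G : Finset J // (G : Set J) ⊆ I} => E G) fun t => by
      obtain ⟨v, hv⟩ := hR.exists_family_free h hD hb U (G := t.sup Subtype.val) (j := j)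
        fun hjt => by
          obtain ⟨G, -, hjG⟩ := Finset.mem_sup.1 hjt
          exact hj (G.2 hjG)
      exact ⟨v, fun G hG => hE_anti (Finset.le_sup (f := Subtype.val) hG) hv⟩
  have hUU' : AgreeOn L D I U U' := fun G hG =>
    (typeOver_eq_of_eventually (U := U.map (· ∘ Prod.map ((↑) : G → J) id))
      (eventually_map.2 (mem_of_superset (hU' ⟨G, hG⟩) fun v hv => hv.1))).symm
  refine ⟨U', hUU', mem_of_superset (hU' ⟨∅, by simp⟩) fun v hv => hv.2.1, fun n u hu => ?_⟩
  let G := Finset.univ.image u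
  have hG : (G : Set J) ⊆ I := by simpa [G, range_subset_iff] using hu
  let u' : Fin n → G := fun i => ⟨u i, Finset.mem_image_of_mem u (Finset.mem_univ i)⟩
  filter_upwards [hU' ⟨G, hG⟩] with v hv
  exact ⟨(typeOver_map hv.1 (Prod.map u' id)).trans (hUU'.typeAt_eq hu),
    hR.mono _ _ _ (finite_range _) hv.2.2
      (range_comp_subset_range (Prod.map u' id) (v ∘ Prod.map ((↑) : G → J) id))⟩

theorem IsFreeOn.exists_extension [Preorder J] (hR : IsFreeness L D R) (h : IsMonster L 𝕄 κ)
    (hD : #D < κ) [Finite ι] (hb : R b ∅) {j : J} (hU : IsFreeOn L D R b U (Iio j)) :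
    ∃ U' : Ultrafilter (J × ι → 𝕄),
      IsFreeOn L D R b U' (insert j (Iio j)) ∧ AgreeOn L D (Iio j) U U' := by
  obtain ⟨U', hUU', hbase, hfree⟩ :=
    hR.exists_agreeOn_eventually h hD hb U (I := Iio j) self_notMem_Iio
  have hU' := hU.of_agreeOn hUU'
  refine ⟨U', ⟨?_, fun n u hu huI x hx => ?_⟩, hUU'⟩
  · rintro i (rfl | hi)
    · exact typeOver_eq_of_eventually (U := pure b)
        (eventually_map.2 (hbase.mono fun v hv => sameType_iff_typeOver_eq.1 hv))
    · exact hU'.base i hi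
  rcases huI (Fin.last n) with hlast | hlast
  · have hinit (i : Fin n) : (u ∘ Fin.castSucc) i ∈ Iio j :=
      (hu (Fin.castSucc_lt_last i)).trans_eq hlast
    refine hR.of_eventually h hD hx _ _ (eventually_map.2 ?_)
    filter_upwards [hfree n _ hinit] with v hv
    constructor
    · exact sameType_iff_typeOver_eq.2
        (hv.1.trans (typeOver_map hx (Prod.map Fin.castSucc id)).symm)
    · rw [← hlast] at hv
      exact hv.2
  · exact hU'.free n u hu (fun i => (hu.monotone (Fin.le_last i)).trans_lt hlast) x hx

variable (L D R b J) in
/-- A free sequence along an initial segment of `J`: an approximation, in the Zorn argument, to a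
free sequence along `J`. -/
structure FreeInitialSegment [Preorder J] where
  index : Set J
  isLowerSet : IsLowerSet index
  family : Ultrafilter (J × ι → 𝕄)
  isFreeOn : IsFreeOn L D R b family index

/-- The free sequence `q` prolongs the free sequence `p`. -/
def FreeInitialSegment.Extends [Preorder J] (q p : FreeInitialSegment L D R b J) : Prop :=
  p.index ⊆ q.index ∧ AgreeOn L D p.index p.family q.family

theorem FreeInitialSegment.exists_extends_of_isChain [Preorder J] [Nonempty (J × ι → 𝕄)]
    {c : Set (FreeInitialSegment L D R b J)} (hc : IsChain (fun p q => q.Extends p) c) :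
    ∃ q : FreeInitialSegment L D R b J, ∀ p ∈ c, q.Extends p := by
  have hneBot : (⨅ p : c, agreeFilter L D p.1.index p.1.family).NeBot :=
    iInf_neBot_of_directed
      (IsChain.directed (f := fun p : FreeInitialSegment L D R b J =>
        agreeFilter L D p.index p.family) (hc.mono_rel fun _ _ h => h.2.agreeFilter_le h.1))
      fun p => p.1.family.neBot.mono (le_agreeFilter_iff.2 (AgreeOn.refl _ _))
  let U := Ultrafilter.of (⨅ p : c, agreeFilter L D p.1.index p.1.family)
  have hagree (p) (hp : p ∈ c) : AgreeOn L D p.index p.family U :=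
    le_agreeFilter_iff.1 ((Ultrafilter.of_le _).trans (iInf_le_of_le ⟨p, hp⟩ le_rfl))
  refine ⟨⟨⋃ p ∈ c, p.index, isLowerSet_iUnion₂ fun p _ => p.isLowerSet, U, ?_, ?_⟩,
    fun p hp => ⟨subset_biUnion_of_mem (u := index) hp, hagree p hp⟩⟩
  · intro j hj
    obtain ⟨p, hp, hj⟩ := mem_iUnion₂.1 hj
    exact (p.isFreeOn.of_agreeOn (hagree p hp)).base j hj
  · intro n u hu huI
    obtain ⟨p, hp, hlast⟩ := mem_iUnion₂.1 (huI (Fin.last n))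
    exact (p.isFreeOn.of_agreeOn (hagree p hp)).free n u hu
      fun i => p.isLowerSet (hu.monotone (Fin.le_last i)) hlast

theorem IsFreeness.exists_isFreeOn_univ (hR : IsFreeness L D R) (h : IsMonster L 𝕄 κ)
    (hD : #D < κ) [Finite ι] (hb : R b ∅) (J : Type x) [LinearOrder J] [WellFoundedLT J] :
    ∃ U : Ultrafilter (J × ι → 𝕄), IsFreeOn L D R b U univ := by
  have : Nonempty (J × ι → 𝕄) := ⟨b ∘ Prod.snd⟩
  obtain ⟨⟨I, hI, U, hU⟩, hmax⟩ := exists_maximal_of_chains_bounded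
    (r := fun p q : FreeInitialSegment L D R b J => q.Extends p)
    (fun c hc => FreeInitialSegment.exists_extends_of_isChain hc)
    fun hpq hqs => ⟨hpq.1.trans hqs.1, hpq.2.trans (hqs.2.mono hpq.1)⟩
  obtain rfl | ⟨j, rfl⟩ := hI.eq_univ_or_Iio
  · exact ⟨U, hU⟩
  obtain ⟨U', hU', hUU'⟩ := hU.exists_extension hR h hD hb
  have hjj := (hmax ⟨insert j (Iio j), Iio_insert (a := j) ▸ isLowerSet_Iic j, U', hU'⟩
    ⟨subset_insert _ _, hUU'⟩).1 (mem_insert _ _)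
  exact absurd hjj self_notMem_Iio

end FreeSequences

section ErdosRado

theorem exists_wellOrder_forall_strictMono {C : Type w} (J : C → Type w)
    [∀ c, LinearOrder (J c)] [∀ c, WellFoundedLT (J c)] :
    ∃ (K : Type w) (_ : LinearOrder K) (_ : WellFoundedLT K), ∀ c, ∃ h : J c → K, StrictMono h := by
  let o : Ordinal.{w} := ⨆ c, Ordinal.type ((· < ·) : J c → J c → Prop)
  refine ⟨o.ToType, inferInstance, inferInstance, fun c => ?_⟩
  have hle : Ordinal.type ((· < ·) : J c → J c → Prop) ≤
      Ordinal.type ((· < ·) : o.ToType → o.ToType → Prop) :=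
    (Ordinal.le_iSup (fun c => Ordinal.type ((· < ·) : J c → J c → Prop)) c).trans_eq
      (Ordinal.type_toType o).symm
  obtain ⟨f⟩ := Ordinal.type_le_iff'.1 hle
  exact ⟨f, fun _ _ => f.map_rel_iff.2⟩

theorem exists_forall_typeAt_eq {L : FirstOrder.Language.{u, v}} {𝕄 : Type w} [L.Structure 𝕄]
    (D : Set 𝕄) {ι : Type} {𝒰 : ∀ (J : Type w) [LinearOrder J], Set (Ultrafilter (J × ι → 𝕄))}
    (hmap : ∀ (J K : Type w) [LinearOrder J] [LinearOrder K] (h : K → J), StrictMono h →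
      ∀ U ∈ 𝒰 J, U.map (· ∘ Prod.map h id) ∈ 𝒰 K)
    (hne : ∀ (J : Type w) [LinearOrder J] [WellFoundedLT J], (𝒰 J).Nonempty) (n : ℕ) :
    ∃ t : Filter (Fin n × ι → 𝕄), ∀ (J : Type w) [LinearOrder J] [WellFoundedLT J],
      ∃ U ∈ 𝒰 J, ∀ u : Fin n → J, StrictMono u → typeAt L D U u = t := by
  by_contra! hcon
  choose J _ _ hJ using hcon
  obtain ⟨K, _, _, hK⟩ := exists_wellOrder_forall_strictMono J
  obtain ⟨N, _, _, hN⟩ := exists_homogeneous n (Filter (Fin n × ι → 𝕄)) K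
  obtain ⟨U, hU⟩ := hne N
  obtain ⟨h, hh, t, ht⟩ := hN fun u => typeAt L D U u
  obtain ⟨g, hg⟩ := hK t
  obtain ⟨u, hu, hut⟩ := hJ t _ (hmap _ _ (h ∘ g) (hh.comp hg) U hU)
  exact hut (ht (g ∘ u) (hg.comp hu))

end ErdosRado

section Sequences

theorem exists_seq_of_forall_exists_extension {X : Type x} {P : ∀ n, (Fin (n + 1) → X) → Prop}
    {a : X} (h0 : P 0 fun _ => a)
    (hsucc : ∀ n x, P n x → ∃ x', P (n + 1) x' ∧ x' ∘ Fin.castSucc = x) :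
    ∃ c : ℕ → X, c 0 = a ∧ ∀ n, P n fun i => c i := by
  choose next hnext hinit using hsucc
  let p : ∀ n, {x // P n x} := fun n =>
    Nat.rec ⟨fun _ => a, h0⟩ (fun n x => ⟨next n x.1 x.2, hnext n x.1 x.2⟩) n
  have hp (n : ℕ) : (p n).1 = fun i : Fin (n + 1) => (p i).1 (Fin.last i) := by
    induction n with
    | zero => exact funext fun i => by rw [Fin.fin_one_eq_zero i]; rfl
    | succ n ih =>
      ext i
      induction i using Fin.lastCases with
      | last => rfl
      | cast i => exact congrFun ((hinit n _ (p n).2).trans ih) i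
  exact ⟨fun k => (p k).1 (Fin.last k), rfl, fun n => hp n ▸ (p n).2⟩

theorem exists_strictMono_extension {n N : ℕ} (hnN : n ≤ N) {i : Fin n → ℕ} (hi : StrictMono i) :
    ∃ u : Fin N → ℕ, StrictMono u ∧ u ∘ Fin.castLE hnN = i := by
  obtain ⟨m, hm⟩ := (finite_range i).bddAbove
  refine ⟨fun k => if hk : k < n then i ⟨k, hk⟩ else m + 1 + k, fun k l hkl => ?_, ?_⟩
  · have hm' (k) : i k ≤ m := hm ⟨k, rfl⟩
    have : (k : ℕ) < l := hkl
    dsimp only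
    split_ifs with hk hl
    · exact hi hkl
    · have := hm' ⟨k, hk⟩
      omega
    · omega
    · omega
  · ext k
    simp

theorem range_initial_eq_biUnion {α : Type x} {X : Type y} (c : ℕ → α → X) (n : ℕ) :
    range (fun p : Fin n × α => c p.1 p.2) = ⋃ j < n, range (c j) := by
  ext a
  simp [Fin.exists_iff]

end Sequences

section IndiscernibleFreeSequences

variable {L : FirstOrder.Language.{u, v}} {𝕄 : Type w} [L.Structure 𝕄] {D : Set 𝕄}
  {κ : Cardinal.{w}} {ι : Type} {R : (ι → 𝕄) → Set 𝕄 → Prop} {b : ι → 𝕄}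

theorem IsFreeOn.map {J K : Type*} [Preorder J] [Preorder K] {U : Ultrafilter (J × ι → 𝕄)}
    (hU : IsFreeOn L D R b U univ) {h : K → J} (hh : StrictMono h) :
    IsFreeOn L D R b (U.map (· ∘ Prod.map h id)) univ where
  base j _ := hU.base (h j) (mem_univ _)
  free n u hu _ x hx := hU.free n (h ∘ u) (hh.comp hu) (fun _ => mem_univ _) x hx

variable (L D R b) in
/-- There are arbitrarily long free sequences in `tp(b/D)` all of whose increasing `n`-tuples have
the type of `x` over `D`. -/
def IsLongFree {n : ℕ} (x : Fin n → ι → 𝕄) : Prop :=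
  ∀ (J : Type w) [LinearOrder J] [WellFoundedLT J], ∃ U : Ultrafilter (J × ι → 𝕄),
    IsFreeOn L D R b U univ ∧ ∀ u : Fin n → J, StrictMono u →
      typeAt L D U u = typeOver L D (pure fun p => x p.1 p.2 : Filter (Fin n × ι → 𝕄))

theorem IsFreeness.isLongFree_const (hR : IsFreeness L D R) (h : IsMonster L 𝕄 κ) (hD : #D < κ)
    [Finite ι] (hb : R b ∅) : IsLongFree L D R b fun _ : Fin 1 => b := fun J _ _ => by
  obtain ⟨U, hU⟩ := hR.exists_isFreeOn_univ h hD hb J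
  refine ⟨U, hU, fun u _ => ?_⟩
  have hu : u = fun _ => u 0 := funext fun i => congrArg u (Subsingleton.elim i 0)
  rw [hu]
  exact typeOver_map (hU.base (u 0) (mem_univ _)) Prod.snd

namespace IsLongFree

variable {n N : ℕ}

theorem exists_extension (h : IsMonster L 𝕄 κ) (hD : #D < κ) [Finite ι] {x : Fin n → ι → 𝕄}
    (hx : IsLongFree L D R b x) :
    ∃ x' : Fin (n + 1) → ι → 𝕄, IsLongFree L D R b x' ∧ x' ∘ Fin.castSucc = x := by
  obtain ⟨t, ht⟩ := exists_forall_typeAt_eq D (L := L) (n := n + 1)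
    (𝒰 := fun J _ => {U | IsFreeOn L D R b U univ ∧ ∀ u : Fin n → J, StrictMono u →
      typeAt L D U u = typeOver L D (pure fun p => x p.1 p.2 : Filter (Fin n × ι → 𝕄))})
    (fun J K _ _ k hk U hU => ⟨hU.1.map hk, fun u hu => hU.2 (k ∘ u) (hk.comp hu)⟩)
    hx
  obtain ⟨U, ⟨-, hUx⟩, hUt⟩ := ht (ULift.{w} ℕ)
  let val : Fin (n + 1) → ULift.{w} ℕ := fun i => ⟨i⟩
  have hval : StrictMono val := fun i j hij => hij
  obtain ⟨y, hy⟩ := h.exists_realizes hD (U.map (· ∘ Prod.map val id))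
  replace hy : typeOver L D (pure y : Filter (Fin (n + 1) × ι → 𝕄)) = t := hy.trans (hUt val hval)
  have hyx : SameType L D (y ∘ Prod.map Fin.castSucc id) fun p : Fin n × ι => x p.1 p.2 := by
    refine sameType_iff_typeOver_eq.2 (Eq.trans ?_ (hUx (val ∘ Fin.castSucc) fun i j hij => hij))
    exact typeOver_map (hy.trans (hUt val hval).symm) (Prod.map Fin.castSucc id)
  obtain ⟨σ, hσ, hσy⟩ := h.exists_equiv hD hyx
  refine ⟨fun i k => σ (y (i, k)), fun J _ _ => ?_, ?_⟩
  · obtain ⟨U, hU, hUt⟩ := ht J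
    exact ⟨U, hU.1, fun u hu => (hUt u hu).trans
      (hy.symm.trans (sameType_iff_typeOver_eq.1 (sameType_of_fixing hσ y)))⟩
  · ext i k
    exact congrFun hσy (i, k)

theorem sameType (i j : Fin n → Fin N) (hi : StrictMono i) (hj : StrictMono j) {x : Fin N → ι → 𝕄}
    (hx : IsLongFree L D R b x) :
    SameType L D (fun p : Fin n × ι => x (i p.1) p.2) fun p : Fin n × ι => x (j p.1) p.2 := by
  obtain ⟨U, -, hU⟩ := hx (ULift.{w} ℕ)
  have hnN : n ≤ N := by simpa using Fintype.card_le_of_injective i hi.injective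
  have hcastLE (i : Fin n → Fin N) (hi : StrictMono i) :
      typeOver L D (pure fun p => x (i p.1) p.2 : Filter (Fin n × ι → 𝕄)) =
        typeOver L D (pure fun p => x (Fin.castLE hnN p.1) p.2 : Filter (Fin n × ι → 𝕄)) := by
    obtain ⟨u, hu, hui⟩ := exists_strictMono_extension (i := fun k => (i k : ℕ)) hnN hi
    calc _ = typeAt L D U ((fun k : Fin N => ULift.up k.1) ∘ i) :=
          (typeOver_map (hU (fun k => ⟨k⟩) fun _ _ h => h) (Prod.map i id)).symm
      _ = typeAt L D U ((ULift.up ∘ u) ∘ Fin.castLE hnN) := by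
          rw [Function.comp_assoc, hui]
          rfl
      _ = _ := typeOver_map (hU _ fun _ _ h => hu h) (Prod.map (Fin.castLE hnN) id)
  exact sameType_iff_typeOver_eq.2 ((hcastLE i hi).trans (hcastLE j hj).symm)

theorem lastFree {x : Fin (n + 1) → ι → 𝕄} (hx : IsLongFree L D R b x) :
    R (x (Fin.last n)) (range fun p : Fin n × ι => x p.1.castSucc p.2) := by
  obtain ⟨U, hU, hUx⟩ := hx (ULift.{w} ℕ)
  have hval : StrictMono fun i : Fin (n + 1) => ULift.up.{w} (i : ℕ) := fun _ _ h => h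
  exact hU.free n _ hval (fun _ => mem_univ _) _ (hUx _ hval).symm

end IsLongFree

theorem IsFreeness.exists_isIndiscernible (hR : IsFreeness L D R) (h : IsMonster L 𝕄 κ)
    (hD : #D < κ) [Finite ι] (hb : R b ∅) :
    ∃ c : ℕ → ι → 𝕄, c 0 = b ∧ IsIndiscernible L D c ∧ ∀ n, R (c n) (⋃ j < n, range (c j)) := by
  obtain ⟨c, hcb, hc⟩ := exists_seq_of_forall_exists_extension
    (P := fun n (x : Fin (n + 1) → ι → 𝕄) => IsLongFree L D R b x) (hR.isLongFree_const h hD hb)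
    fun n x hx => hx.exists_extension h hD
  refine ⟨c, hcb, fun n i j hi hj => ?_, fun n => ?_⟩
  · obtain ⟨N, hN⟩ := ((finite_range i).union (finite_range j)).bddAbove
    exact (hc N).sameType (fun k => ⟨i k, Nat.lt_succ_of_le (hN (Or.inl ⟨k, rfl⟩))⟩)
      (fun k => ⟨j k, Nat.lt_succ_of_le (hN (Or.inr ⟨k, rfl⟩))⟩) hi hj
  · rw [← range_initial_eq_biUnion]
    exact (hc n).lastFree

end IndiscernibleFreeSequences

section FreeTypes

variable {L : FirstOrder.Language.{u, v}} {𝕄 : Type w} [L.Structure 𝕄] {D : Set 𝕄}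
  {ι : Type w'} {R : (ι → 𝕄) → Set 𝕄 → Prop} {c : ℕ → ι → 𝕄}

theorem IsIndiscernible.sameType (hc : IsIndiscernible L D c) {n N : ℕ} (hnN : n ≤ N) :
    SameType L (D ∪ ⋃ j < n, range (c j)) (c n) (c N) := by
  rw [← range_initial_eq_biUnion, sameType_union_range_iff]
  have hmono : StrictMono fun i : Fin (n + 1) => if (i : ℕ) < n then (i : ℕ) else N := by
    intro i j hij
    have hij' : (i : ℕ) < j := hij
    dsimp only
    split_ifs <;> omega
  convert! (hc (n + 1) (fun i => i) _ (fun i j hij => hij) hmono).comp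
    (Sum.elim (Prod.mk (Fin.last n)) (Prod.map Fin.castSucc id) : ι ⊕ (Fin n × ι) → _) using 1 <;>
  · ext (i | i) <;> simp

theorem IsFreeness.exists_free_ultrafilter (hR : IsFreeness L D R) [Finite ι]
    (hind : IsIndiscernible L D c) (hfree : ∀ n, R (c n) (⋃ j < n, range (c j))) :
    ∃ Q : Ultrafilter (ι → 𝕄),
      (∀ n, typeOver L (D ∪ ⋃ j < n, range (c j)) (pure (c n) : Filter (ι → 𝕄)) =
        typeOver L (D ∪ ⋃ j < n, range (c j)) (Q : Filter (ι → 𝕄))) ∧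
      ∀ B : Set 𝕄, B.Finite → ∀ᶠ b in (Q : Filter (ι → 𝕄)), R b B := by
  classical
  let E (s : ℕ × Finset 𝕄) : Set (ι → 𝕄) :=
    {b | SameType L (D ∪ ⋃ j < s.1, range (c j)) b (c s.1) ∧ R b s.2}
  have hE_anti : Antitone E := fun s s' hs b hb =>
    ⟨(hb.1.mono (union_subset_union_right D (biUnion_subset_biUnion_left fun j hj =>
      lt_of_lt_of_le hj hs.1))).trans (hind.sameType hs.1).symm,
    hR.mono b _ _ s'.2.finite_toSet hb.2 (Finset.coe_subset.2 hs.2)⟩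
  have hE_nonempty (s : ℕ × Finset 𝕄) : (E s).Nonempty := by
    have hfin : (⋃ j < s.1, range (c j)).Finite :=
      (finite_Iio s.1).biUnion fun j _ => finite_range (c j)
    obtain ⟨b, hb, hRb⟩ := hR.extension (c s.1) _ _ (hfin.union s.2.finite_toSet) (hfree s.1)
      subset_union_left
    exact ⟨b, hb.symm, hR.mono b _ _ (hfin.union s.2.finite_toSet) hRb subset_union_right⟩
  obtain ⟨Q, hQ⟩ := exists_ultrafilter_forall_mem (S := E) fun t =>
    (hE_nonempty (t.sup id)).imp fun b hb s hs => hE_anti (Finset.le_sup (f := id) hs) hb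
  refine ⟨Q, fun n => ?_, fun B hB => mem_of_superset (hQ (0, hB.toFinset)) fun b hb => ?_⟩
  · exact (typeOver_eq_of_eventually (U := pure (c n)) (mem_of_superset (hQ (n, ∅)) fun b hb =>
      sameType_iff_typeOver_eq.1 hb.1)).symm
  · simpa using hb.2

end FreeTypes

section ConantDividing

variable {L : FirstOrder.Language.{u, v}} {𝕄 : Type w} [L.Structure 𝕄] (κ : Cardinal.{w})
  (Ind : TernaryRel 𝕄) (M : L.ElementarySubstructure 𝕄)

/-- The properties of an independence relation over a fixed model `M`, for finite left sides, on
which chain local character rests. -/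
structure IsIndepOver : Prop where
  invariant : ∀ σ : 𝕄 ≃[L] 𝕄, (∀ c ∈ (M : Set 𝕄), σ c = c) → ∀ A B : Set 𝕄, A.Finite → #B < κ →
    Ind A M B → Ind (σ '' A) M (σ '' B)
  left_mono : ∀ A A' B : Set 𝕄, A.Finite → #B < κ → Ind A M B → A' ⊆ A → Ind A' M B
  right_mono : ∀ A B B' : Set 𝕄, A.Finite → #B < κ → Ind A M B → B' ⊆ B → Ind A M B'
  strongFiniteCharacter : ∀ {ι : Type} [Finite ι] (b : ι → 𝕄) (B : Set 𝕄), #B < κ →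
    ¬ Ind (range b) M B → ∃ S, ((M : Set 𝕄) ∪ B).Definable L S ∧ b ∈ S ∧
      ∀ b' ∈ S, ¬ Ind (range b') M B
  extension : ∀ {ι : Type} [Finite ι] (b : ι → 𝕄) (B B' : Set 𝕄), #B' < κ →
    Ind (range b) M B → B ⊆ B' → ∃ b', SameType L ((M : Set 𝕄) ∪ B) b b' ∧ Ind (range b') M B'
  of_subset : ∀ A B : Set 𝕄, A.Finite → #B < κ → A ⊆ (M : Set 𝕄) → Ind A M B

variable {κ Ind M}

namespace IsIndepOver

/-- Independence from `E` is built into freeness by enlarging the right sides by `E`, so that free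
sequences over `M ∪ E` are, over `M`, free also from `E`. -/
theorem isFreeness (hI : IsIndepOver κ Ind M) (h : IsMonster L 𝕄 κ) {E : Set 𝕄} (hE : #E < κ)
    (ι : Type) [Finite ι] :
    IsFreeness L ((M : Set 𝕄) ∪ E) fun (b : ι → 𝕄) B => Ind (range b) M (E ∪ B) where
  invariant σ hσ b B hB hb := by
    have := hI.invariant σ (fun c hc => hσ c (Or.inl hc)) _ _ (finite_range b)
      (h.card_union_lt hE (h.card_lt_of_finite hB)) hb
    rwa [image_union, image_eq_of_fixing fun c hc => hσ c (Or.inr hc), ← range_comp] at this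
  mono b B B' hB hb hBB' := hI.right_mono _ _ _ (finite_range b)
    (h.card_union_lt hE (h.card_lt_of_finite hB)) hb (union_subset_union_right E hBB')
  strongFiniteCharacter b B hB hb := by
    rw [union_assoc]
    exact hI.strongFiniteCharacter b _ (h.card_union_lt hE (h.card_lt_of_finite hB)) hb
  extension b B B' hB' hb hBB' := by
    rw [union_assoc]
    exact hI.extension b _ _ (h.card_union_lt hE (h.card_lt_of_finite hB')) hb
      (union_subset_union_right E hBB')

theorem isFree (hI : IsIndepOver κ Ind M) {ι : Type} [Finite ι]
    {q : GlobalType L 𝕄 ι} {Q : Ultrafilter (ι → 𝕄)} (hq : IsTypeOfUltrafilter q Q)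
    (hQ : ∀ B : Set 𝕄, B.Finite → ∀ᶠ b in (Q : Filter (ι → 𝕄)), Ind (range b) M B) :
    IsFree κ Ind q (M : Set 𝕄) := by
  intro B hB x hx
  by_contra hxB
  obtain ⟨S, hS, hxS, hdependent⟩ := hI.strongFiniteCharacter x B hB hxB
  have hQS : ∀ᶠ b in (Q : Filter (ι → 𝕄)), b ∈ S :=
    (typeOver_eq_iff.1 (hq.realizesRestrict_iff.1 hx) S hS).1 hxS
  obtain ⟨B₀, hB₀, hS₀⟩ := definable_iff_finitely_definable.1 hS
  have hfin : (B ∩ (B₀ : Set 𝕄)).Finite := B₀.finite_toSet.inter_of_right B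
  have hS' : ((M : Set 𝕄) ∪ (B ∩ B₀)).Definable L S :=
    hS₀.mono fun z hz => (hB₀ hz).imp_right fun hzB => ⟨hzB, hz⟩
  obtain ⟨b, hbS, hb⟩ := (hQS.and (hQ _ hfin)).exists
  obtain ⟨b', hbb', hb'⟩ := hI.extension b _ B hB hb inter_subset_left
  exact hdependent b' ((sameType_iff_definable.1 hbb' S hS').1 hbS) hb'

theorem not_conantDivides [Nonempty 𝕄] (hI : IsIndepOver κ Ind M) (h : IsMonster L 𝕄 κ)
    (hM : #(M : Set 𝕄) < κ) {m : ℕ} {b : Fin m → 𝕄} {α : Type w'} {a : α → 𝕄}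
    (ha : #(range a) < κ) (hb : Ind (range b) M (range a))
    (φ : L[[(M : Set 𝕄)]].Formula (α ⊕ Fin m)) (hφ : φ.Realize (Sum.elim a b)) :
    ¬ ConantDivides κ Ind (M : Set 𝕄) φ b := by
  intro hdiv
  have hR := hI.isFreeness h ha (Fin m)
  obtain ⟨c, rfl, hind, hfree⟩ := hR.exists_isIndiscernible h (h.card_union_lt hM ha) (b := b)
    (by rwa [union_empty])
  obtain ⟨Q, hcQ, hQ⟩ := hR.exists_free_ultrafilter hind hfree
  obtain ⟨q, hq⟩ := exists_globalType_isTypeOfUltrafilter (L := L) Q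
  have hqfree : IsFree κ Ind q (M : Set 𝕄) := hI.isFree hq fun B hB =>
    (hQ B hB).mono fun b hb => hI.right_mono _ _ _ (finite_range b)
      (h.card_union_lt ha (h.card_lt_of_finite hB)) hb subset_union_right
  have hMorley : IsMorleyIn q (M : Set 𝕄) c := fun n => hq.realizesRestrict_iff.2
    (typeOver_eq_of_subset (union_subset_union_left _ subset_union_left) (hcQ n))
  have hindM : IsIndiscernible L (M : Set 𝕄) c := fun n i j hi hj =>
    (hind n i j hi hj).mono subset_union_left
  obtain ⟨s, hs⟩ := hdiv q (hq.realizesRestrict_iff.2 (typeOver_eq_of_subset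
    (subset_union_left.trans subset_union_left) (hcQ 0))) hqfree c hMorley hindM rfl
  refine hs ⟨a, fun i _ => ?_⟩
  have hci : SameType L ((M : Set 𝕄) ∪ range a) (c 0) (c i) :=
    (hind.sameType (Nat.zero_le i)).mono subset_union_left
  have hφi := (sameType_union_range_iff.1 hci).comp Sum.swap φ
  simp only [Sum.elim_swap] at hφi
  exact hφi.1 hφ

end IsIndepOver

end ConantDividing

section Chains

variable (L : FirstOrder.Language.{u, v}) {𝕄 : Type w} [L.Structure 𝕄]

/-- The type of the tuple `c` over `C` is finitely satisfiable in `N`. -/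
def IsFinitelySatisfiableIn (C N : Set 𝕄) {ι : Type x} (c : ι → 𝕄) : Prop :=
  ∀ W, C.Definable L W → c ∈ W → ∃ c' ∈ W, ∀ k, c' k ∈ N

variable {L} {μ : Cardinal.{w}}

theorem aleph0_lt_of_theoryCard_lt
    (hT : Cardinal.lift.{w} (theoryCard L) < Cardinal.lift.{max u v} μ) : ℵ₀ < μ :=
  aleph0_lt_lift.1 ((aleph0_le_lift.2 (le_max_left _ _)).trans_lt hT)

theorem card_definable_lt (hT : Cardinal.lift.{w} (theoryCard L) < Cardinal.lift.{max u v} μ)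
    {B : Set 𝕄} (hB : #B < μ) (α : Type) [Countable α] :
    #{W : Set (α → 𝕄) // B.Definable L W} < μ := by
  have hμ := aleph0_lt_of_theoryCard_lt hT
  have hμ' : ℵ₀ < Cardinal.lift.{max u v} μ := aleph0_lt_lift.2 hμ
  have hBα : #(B ⊕ α) < μ := by
    rw [mk_sum]
    exact add_lt_of_lt hμ.le (by simpa using hB) ((lift_le_aleph0.2 (mk_le_aleph0)).trans_lt hμ)
  have hL : Cardinal.lift.{w} L.card < Cardinal.lift.{max u v} μ :=
    (lift_le.2 (le_max_right _ _)).trans_lt hT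
  have hformula : #(L.Formula (B ⊕ α)) < Cardinal.lift.{max u v} μ :=
    calc #(L.Formula (B ⊕ α)) ≤ #(Σ n, L.BoundedFormula (B ⊕ α) n) :=
          mk_le_of_injective (f := fun φ => ⟨0, φ⟩) fun φ ψ h => by simpa using h
      _ ≤ max ℵ₀ (Cardinal.lift.{max u v} #(B ⊕ α) + Cardinal.lift.{w} L.card) :=
          BoundedFormula.card_le
      _ < Cardinal.lift.{max u v} μ := max_lt hμ' (add_lt_of_lt hμ'.le (lift_lt.2 hBα) hL)
  have hsurj : Function.Surjective fun φ : L.Formula (B ⊕ α) =>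
      (⟨{x | φ.Realize (Sum.elim (↑) x)}, definable_iff_exists_formula_sum.2 ⟨φ, rfl⟩⟩ :
        {W : Set (α → 𝕄) // B.Definable L W}) := by
    rintro ⟨W, hW⟩
    obtain ⟨φ, rfl⟩ := definable_iff_exists_formula_sum.1 hW
    exact ⟨φ, rfl⟩
  have hle := lift_mk_le_lift_mk_of_surjective hsurj
  rw [lift_umax.{w, max u v}, lift_id'.{w, max u v w}] at hle
  exact lift_lt.1 (hle.trans_lt hformula)

theorem exists_isSuccLimit_forall_exists_lt (hμ : μ.IsRegular) (hμ' : ℵ₀ < μ)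
    {G : Ordinal.{w} → Ordinal.{w}} (hG : ∀ j < μ.ord, G j < μ.ord) :
    ∃ i < μ.ord, Order.IsSuccLimit i ∧ ∀ j < i, ∃ k < i, j ≤ k ∧ G k < i := by
  let f : Ordinal.{w} → Ordinal.{w} := fun j => Order.succ (max j (G j))
  have hf : ∀ j < μ.ord, f j < μ.ord := fun j hj =>
    (isSuccLimit_ord hμ.aleph0_le).succ_lt (max_lt hj (hG j hj))
  have hclosed : ∀ j < Ordinal.nfp f 0, ∃ k < Ordinal.nfp f 0, j < k ∧ G k < Ordinal.nfp f 0 := by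
    intro j hj
    obtain ⟨n, hn⟩ := Ordinal.lt_nfp_iff.1 hj
    have hstep : f (f^[n] 0) ≤ Ordinal.nfp f 0 := by
      rw [← Function.iterate_succ_apply' f]
      exact Ordinal.iterate_le_nfp f 0 (n + 1)
    have hlt := (Order.succ_le_iff.1 hstep)
    exact ⟨f^[n] 0, (le_max_left _ _).trans_lt hlt, hn, (le_max_right _ _).trans_lt hlt⟩
  refine ⟨Ordinal.nfp f 0, Cardinal.nfp_lt_ord_of_isRegular hμ hμ'.ne' hf ?_, ?_, fun j hj => ?_⟩
  · exact lt_ord.2 (by simpa using hμ.pos)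
  · refine Ordinal.isSuccLimit_iff.2 ⟨?_, Order.isSuccPrelimit_iff_succ_lt.2 fun j hj => ?_⟩
    · exact ((Order.bot_lt_succ _).trans_le (Ordinal.iterate_le_nfp f 0 1)).ne'
    · obtain ⟨k, hk, hjk, -⟩ := hclosed j hj
      exact (Order.succ_le_of_lt hjk).trans_lt hk
  · obtain ⟨k, hk, hjk, hGk⟩ := hclosed j hj
    exact ⟨k, hk, hjk.le, hGk⟩

variable {M : Ordinal.{w} → L.ElementarySubstructure 𝕄}

theorem IsContinuousChain.exists_subset_of_finite (hM : IsContinuousChain L μ M) {o : Ordinal.{w}}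
    (ho : 0 < o) (hoμ : o ≤ μ.ord) {B : Set 𝕄} (hB : B.Finite)
    (hBM : B ⊆ ⋃ j < o, (M j : Set 𝕄)) : ∃ j < o, B ⊆ M j := by
  have hdir : DirectedOn (fun i j => (M i : Set 𝕄) ⊆ M j) (Iio o) := fun i hi j hj =>
    have hij : max i j < o := max_lt hi hj
    ⟨max i j, hij, hM.1 _ _ (le_max_left i j) (hij.trans_le hoμ),
      hM.1 _ _ (le_max_right i j) (hij.trans_le hoμ)⟩
  obtain ⟨j, hj, hBj⟩ := hdir.exists_mem_subset_of_finset_subset_biUnion ⟨0, ho⟩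
    (s := hB.toFinset) (by simpa using hBM)
  exact ⟨j, hj, by simpa using hBj⟩

theorem IsContinuousChain.exists_stage_meeting (hM : IsContinuousChain L μ M) (hμ : 0 < μ.ord)
    {ι : Type x} [Finite ι] (W : Set (ι → 𝕄)) :
    ∃ i < μ.ord, (∃ c ∈ W, ∀ k, c k ∈ ⋃ j < μ.ord, (M j : Set 𝕄)) →
      ∃ c ∈ W, ∀ k, c k ∈ M i := by
  by_cases hW : ∃ c ∈ W, ∀ k, c k ∈ ⋃ j < μ.ord, (M j : Set 𝕄)
  · obtain ⟨c, hcW, hc⟩ := hW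
    obtain ⟨i, hi, hci⟩ := hM.exists_subset_of_finite hμ le_rfl (finite_range c)
      (range_subset_iff.2 hc)
    exact ⟨i, hi, fun _ => ⟨c, hcW, range_subset_iff.1 hci⟩⟩
  · exact ⟨0, hμ, fun h => (hW h).elim⟩

/-- The stage `i` is closed under choosing, for each set definable over an earlier stage, a stage
that meets it. -/
theorem IsContinuousChain.exists_isFinitelySatisfiableIn (hM : IsContinuousChain L μ M)
    (hμ : μ.IsRegular) (hT : Cardinal.lift.{w} (theoryCard L) < Cardinal.lift.{max u v} μ)
    (hcard : ∀ i < μ.ord, #(M i : Set 𝕄) < μ) {A : Set 𝕄} (hA : #A < μ) :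
    ∃ i < μ.ord, ∀ (p : ℕ) (c : Fin p → 𝕄), (∀ k, c k ∈ ⋃ j < μ.ord, (M j : Set 𝕄)) →
      IsFinitelySatisfiableIn L ((M i : Set 𝕄) ∪ A) (M i) c := by
  have hμ' := aleph0_lt_of_theoryCard_lt hT
  have hpos : 0 < μ.ord := lt_ord.2 (by simpa using hμ.pos)
  choose H hHlt hH using fun (p : ℕ) (W : Set (Fin p → 𝕄)) => hM.exists_stage_meeting hpos W
  let G : Ordinal.{w} → Ordinal.{w} := fun j =>
    ⨆ p, ⨆ W : {W : Set (Fin p → 𝕄) // ((M j : Set 𝕄) ∪ A).Definable L W}, H p W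
  have hG : ∀ j < μ.ord, G j < μ.ord := by
    intro j hj
    have hjA : #((M j : Set 𝕄) ∪ A : Set 𝕄) < μ :=
      (mk_union_le _ _).trans_lt (add_lt_of_lt hμ.aleph0_le (hcard j hj) hA)
    refine Ordinal.lift_iSup_lt_of_lt_cof (by simpa [hμ.cof_ord] using hμ') fun p => ?_
    exact Ordinal.iSup_lt_of_lt_cof (hμ.cof_ord.symm ▸ card_definable_lt hT hjA _)
      fun W => hHlt p W
  obtain ⟨i, hi, hlim, hclosed⟩ := exists_isSuccLimit_forall_exists_lt hμ hμ' hG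
  refine ⟨i, hi, fun p c hcM W hW hcW => ?_⟩
  obtain ⟨B, hB, hWB⟩ := definable_iff_finitely_definable.1 hW
  obtain ⟨j, hj, hBj⟩ := hM.exists_subset_of_finite hlim.bot_lt hi.le
    (B.finite_toSet.sdiff (t := A)) (hM.2 i hi hlim ▸ sdiff_subset_iff.2 (union_comm _ A ▸ hB))
  obtain ⟨k, hk, hjk, hGk⟩ := hclosed j hj
  have hWk : ((M k : Set 𝕄) ∪ A).Definable L W := by
    refine hWB.mono (union_comm A _ ▸ sdiff_subset_iff.1 (hBj.trans ?_))
    exact hM.1 _ _ hjk (hk.trans hi)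
  have hHG : H p W ≤ G k := Ordinal.iSup_le_iff.1 (Ordinal.iSup_le_iff.1 (le_refl (G k)) p) ⟨W, hWk⟩
  obtain ⟨c', hcW', hc'⟩ := hH p W ⟨c, hcW, hcM⟩
  exact ⟨c', hcW', fun l => hM.1 _ _ (hHG.trans hGk.le) hi (hc' l)⟩

end Chains

section Main

variable {L : FirstOrder.Language.{u, v}} {𝕄 : Type w} [L.Structure 𝕄] {κ : Cardinal.{w}}
  {Ind : TernaryRel 𝕄}

theorem exists_definable_union_range {α : Type x} {D C : Set 𝕄} {S : Set (α → 𝕄)}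
    (hS : (D ∪ C).Definable L S) :
    ∃ (p : ℕ) (c : Fin p → 𝕄), (∀ k, c k ∈ C) ∧ (D ∪ range c).Definable L S := by
  obtain ⟨B, hB, hSB⟩ := definable_iff_finitely_definable.1 hS
  obtain ⟨p, c, hc⟩ := (B.finite_toSet.inter_of_right C).fin_embedding
  refine ⟨p, c, fun k => (hc ▸ mem_range_self k : c k ∈ C ∩ B).1, hSB.mono fun z hz => ?_⟩
  rw [hc]
  exact (hB hz).imp_right fun hzC => ⟨hzC, hz⟩

variable {N : L.ElementarySubstructure 𝕄}

/-- Tuples `d'c' ≡_N dc` from `N` itself are independent from `A`, and finite satisfiability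
provides them with `c'` in any given set definable over `N ∪ A` that contains `c`. -/
theorem IsFinitelySatisfiableIn.exists_indep {A : Set 𝕄} {ι ι' : Type} [Finite ι] [Finite ι']
    {c : ι → 𝕄} (hc : IsFinitelySatisfiableIn L ((N : Set 𝕄) ∪ A) N c)
    (hI : IsIndepOver κ Ind N) (hA : #A < κ) {d : ι' → 𝕄} {S : Set (ι' ⊕ ι → 𝕄)}
    (hS : (N : Set 𝕄).Definable L S) (hdS : Sum.elim d c ∈ S) {V : Set (ι → 𝕄)}
    (hV : ((N : Set 𝕄) ∪ A).Definable L V) (hcV : c ∈ V) :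
    ∃ e ∈ S, e ∘ Sum.inr ∈ V ∧ Ind (range e) N A := by
  have hproj : (N : Set 𝕄).Definable L {y : ι → 𝕄 | ∃ z : ι' → 𝕄, Sum.elim z y ∈ S} := by
    convert (hS.preimage_comp Sum.swap).exists_of_finite using 1
    simp
  obtain ⟨c', ⟨hc'S, hc'V⟩, hc'N⟩ := hc _ ((hproj.mono subset_union_left).inter hV) ⟨⟨d, hdS⟩, hcV⟩
  have hfiber : (N : Set 𝕄).Definable L {z : ι' → 𝕄 | Sum.elim z c' ∈ S} :=
    (definable_union_range_of_definable hS c').mono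
      (union_subset subset_rfl (range_subset_iff.2 hc'N))
  obtain ⟨d', hd'S, hd'N⟩ := exists_mem_elementarySubstructure hfiber hc'S
  refine ⟨Sum.elim d' c', hd'S, hc'V, hI.of_subset _ _ (finite_range _) hA ?_⟩
  exact range_subset_iff.2 (Sum.forall.2 ⟨hd'N, hc'N⟩)

theorem IsFinitelySatisfiableIn.exists_ultrafilter_indep {A : Set 𝕄} {ι ι' : Type} [Finite ι]
    [Finite ι'] {c : ι → 𝕄} (hc : IsFinitelySatisfiableIn L ((N : Set 𝕄) ∪ A) N c)
    (hI : IsIndepOver κ Ind N) (hA : #A < κ) (d : ι' → 𝕄) :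
    ∃ U : Ultrafilter (ι' ⊕ ι → 𝕄),
      typeOver L (N : Set 𝕄) (U : Filter (ι' ⊕ ι → 𝕄)) =
        typeOver L (N : Set 𝕄) (pure (Sum.elim d c)) ∧
      typeOver L ((N : Set 𝕄) ∪ A) (map (· ∘ Sum.inr) (U : Filter (ι' ⊕ ι → 𝕄))) =
        typeOver L ((N : Set 𝕄) ∪ A) (pure c) ∧
      ∀ᶠ e in (U : Filter (ι' ⊕ ι → 𝕄)), Ind (range e) N A := by
  let F := typeOver L (N : Set 𝕄) (pure (Sum.elim d c)) ⊓
    comap (· ∘ Sum.inr) (typeOver L ((N : Set 𝕄) ∪ A) (pure c)) ⊓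
    𝓟 {e : ι' ⊕ ι → 𝕄 | Ind (range e) N A}
  have hF : F.NeBot := inf_principal_neBot_iff.2 fun W hW => by
    obtain ⟨S', ⟨S, hdS, hS, hSS'⟩, V', ⟨V₀, ⟨V, hcV, hV, hVV₀⟩, hV₀V'⟩, rfl⟩ := mem_inf_iff.1 hW
    obtain ⟨e, heS, heV, he⟩ := hc.exists_indep hI hA hS hdS hV hcV
    exact ⟨e, ⟨hSS' heS, hV₀V' (hVV₀ heV)⟩, he⟩
  have hU : (Ultrafilter.of F : Filter (ι' ⊕ ι → 𝕄)) ≤ F := Ultrafilter.of_le F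
  exact ⟨Ultrafilter.of F,
    typeOver_eq_iff_le (U := pure (Sum.elim d c)).2 (hU.trans (inf_le_left.trans inf_le_left)),
    typeOver_eq_iff_le (U := pure c).2 (map_le_iff_le_comap.2
      (hU.trans (inf_le_left.trans inf_le_right))),
    hU (mem_inf_of_right (mem_principal_self _))⟩

theorem IsFinitelySatisfiableIn.exists_sameType_indep (h : IsMonster L 𝕄 κ)
    (hN : #(N : Set 𝕄) < κ) {A : Set 𝕄} {ι ι' : Type} [Finite ι] [Finite ι']
    {c : ι → 𝕄} (hc : IsFinitelySatisfiableIn L ((N : Set 𝕄) ∪ A) N c)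
    (hI : IsIndepOver κ Ind N) (hA : #A < κ) (d : ι' → 𝕄) :
    ∃ d', SameType L ((N : Set 𝕄) ∪ range c) d d' ∧ Ind (range d') N A := by
  obtain ⟨U, hUdc, hUc, hUA⟩ := hc.exists_ultrafilter_indep hI hA d
  obtain ⟨e, heU⟩ := h.exists_realizes (h.card_union_lt hN hA) U
  have hdc : SameType L (N : Set 𝕄) (Sum.elim d c) e :=
    sameType_iff_typeOver_eq.2 (hUdc.symm.trans (typeOver_eq_of_subset subset_union_left heU).symm)
  have hec : SameType L ((N : Set 𝕄) ∪ A) (e ∘ Sum.inr) c :=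
    sameType_iff_typeOver_eq.2 ((typeOver_map heU Sum.inr).trans hUc)
  have heA : Ind (range e) N A := by
    by_contra hdep
    obtain ⟨S, hS, heS, hSdep⟩ := hI.strongFiniteCharacter e A hA hdep
    have hUS : ∀ᶠ e in (U : Filter (ι' ⊕ ι → 𝕄)), e ∈ S := (typeOver_eq_iff.1 heU S hS).1 heS
    obtain ⟨e', he'S, he'A⟩ := (hUS.and hUA).exists
    exact hSdep e' he'S he'A
  obtain ⟨σ, hσ, hσc⟩ := h.exists_equiv (h.card_union_lt hN hA) hec
  have hσN : ∀ c ∈ (N : Set 𝕄), σ c = c := fun c hc => hσ c (Or.inl hc)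
  have hσe : σ ∘ e = Sum.elim (σ ∘ e ∘ Sum.inl) c := by
    rw [← hσc]
    exact (Sum.elim_comp_inl_inr _).symm
  refine ⟨σ ∘ e ∘ Sum.inl, sameType_union_range_iff.2 ?_, ?_⟩
  · exact hσe ▸ hdc.trans (sameType_of_fixing hσN e)
  · have hσA := hI.invariant σ hσN _ _ (finite_range _) hA
      (hI.left_mono _ _ _ (finite_range e) hA heA (range_comp_subset_range Sum.inl e))
    rwa [image_eq_of_fixing fun c hc => hσ c (Or.inr hc), ← range_comp] at hσA

/-- A forking formula of `tp(A/NC)` involves only a finite tuple `c` from `C`. Moving a conjugate of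
the dividing parameters that is independent from `A` back over `Nc` yields a conjugate of `A` that
satisfies one of the dividing formulas and from which its parameters are independent. -/
theorem conantIndep_of_isFinitelySatisfiableIn [Nonempty 𝕄] (h : IsMonster L 𝕄 κ)
    (hN : #(N : Set 𝕄) < κ) (hI : IsIndepOver κ Ind N) {A C : Set 𝕄} (hA : #A < κ)
    (hfs : ∀ (p : ℕ) (c : Fin p → 𝕄), (∀ k, c k ∈ C) →
      IsFinitelySatisfiableIn L ((N : Set 𝕄) ∪ A) N c) :
    ConantIndep L κ Ind A N C := by
  rintro ⟨φ, hφ, n, m, ψ, d, hdiv, himp⟩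
  obtain ⟨p, c, hcC, hφc⟩ := exists_definable_union_range ⟨φ, rfl⟩
  obtain ⟨d', hdd', hd'A⟩ := (hfs p c hcC).exists_sameType_indep h hN hI hA
    fun z : Σ k, Fin (m k) => d z.1 z.2
  obtain ⟨σ, hσ, hσd⟩ := h.exists_equiv
    (h.card_union_lt hN (h.card_lt_of_finite (finite_range c))) hdd'.symm
  obtain ⟨k, hk⟩ := himp (σ ∘ (↑)) ((mem_iff_of_definable_of_fixing hφc σ hσ _).2 hφ)
  have hdk : d k = σ ∘ fun l => d' ⟨k, l⟩ := funext fun l => (congrFun hσd ⟨k, l⟩).symm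
  have hdkA : Ind (range (d k)) N (range (σ ∘ ((↑) : A → 𝕄))) := by
    rw [hdk, range_comp, range_comp, Subtype.range_coe]
    exact hI.invariant σ (fun c hc => hσ c (Or.inl hc)) _ _ (finite_range _) hA
      (hI.left_mono _ _ _ (finite_range d') hA hd'A (range_comp_subset_range (Sigma.mk k) d'))
  have hσA : #(range (σ ∘ ((↑) : A → 𝕄))) < κ := mk_range_le.trans_lt hA
  exact hI.not_conantDivides h hN hσA hdkA (ψ k) hk (hdiv k)

theorem chainLocalCharacter_conantIndep [Nonempty 𝕄] (h : IsMonster L 𝕄 κ)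
    (hI : ∀ N : L.ElementarySubstructure 𝕄, #(N : Set 𝕄) < κ → IsIndepOver κ Ind N) :
    ChainLocalCharacter L κ (ConantIndep L κ Ind) := by
  intro A hA μ hμ hμκ hT M hM hcard
  obtain ⟨i, hi, hfs⟩ := hM.exists_isFinitelySatisfiableIn hμ hT hcard
    ((lt_aleph0_iff_set_finite.2 hA).trans_le hμ.aleph0_le)
  have hiκ := (hcard i hi).trans hμκ
  exact ⟨i, hi, conantIndep_of_isFinitelySatisfiableIn h hiκ (hI _ hiκ)
    (h.card_lt_of_finite hA) hfs⟩

end Main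

section Axioms

variable {L : FirstOrder.Language.{u, v}} {𝕄 : Type w} [L.Structure 𝕄] {κ : Cardinal.{w}}
  {Ind : TernaryRel 𝕄}

theorem SameType.apply_eq_of_subset {C A : Set 𝕄} (hAC : A ⊆ C) {f : A → 𝕄}
    (h : SameType L C (fun x : A => (x : 𝕄)) f) (x : A) : f x = x := by
  have hdef : C.Definable L {y : A → 𝕄 | y x = (x : 𝕄)} := by
    rw [definable_iff_exists_formula_sum]
    refine ⟨Term.equal (Term.var (Sum.inr x)) (Term.var (Sum.inl ⟨x, hAC x.2⟩)), ?_⟩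
    ext y
    simp only [mem_ofPred_eq, Formula.realize_equal, Term.realize_var, Sum.elim_inl, Sum.elim_inr]
  exact (sameType_iff_definable.1 h _ hdef).1 rfl

theorem isIndepOver_of_axioms (h : IsMonster L 𝕄 κ) (hinv : IsIndependenceRelation L Ind)
    (hex : FullExistence L κ Ind) (hmono : Monotonicity L κ Ind)
    (hsfc : StrongFiniteCharacter L κ Ind) (hext : RightExtension L κ Ind)
    (M : L.ElementarySubstructure 𝕄) (hM : #(M : Set 𝕄) < κ) : IsIndepOver κ Ind M where
  invariant σ hσ A B _ _ hAB := by
    have himage := hinv σ _ _ _ hAB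
    rwa [image_eq_of_fixing hσ] at himage
  left_mono A A' B hA hB hAB hAA' := hmono.1 M A A' B hM (h.card_lt_of_finite hA) hB hAB hAA'
  right_mono A B B' hA hB hAB hBB' := hmono.2 M A B B' hM (h.card_lt_of_finite hA) hB hAB hBB'
  strongFiniteCharacter b B hB hb := by
    obtain ⟨φ, hφ, hdependent⟩ := hsfc M _ B hM (h.card_lt_of_finite (finite_range b)) hB hb
    have hdef : ((M : Set 𝕄) ∪ B).Definable L (Set.ofPred φ.Realize) := ⟨φ, rfl⟩
    refine ⟨{y | y ∘ rangeSplitting b ∈ Set.ofPred φ.Realize}, hdef.preimage_comp _, ?_, ?_⟩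
    · rw [mem_ofPred_eq, comp_rangeSplitting]
      exact hφ
    · exact fun b' hb' hindep => hdependent _ hb' (hmono.1 M _ _ B hM
        (h.card_lt_of_finite (finite_range b')) hB hindep (range_comp_subset_range _ _))
  extension b B B' hB' hb hBB' := by
    obtain ⟨_, ⟨f, rfl, hf⟩, hindep⟩ := hext M _ B B' hM (h.card_lt_of_finite (finite_range b))
      ((mk_le_mk_of_subset hBB').trans_lt hB') hB' hb hBB'
    refine ⟨f ∘ rangeFactorization b, hf.comp (rangeFactorization b), ?_⟩
    rwa [rangeFactorization_surjective.range_comp]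
  of_subset A B hA hB hAM := by
    obtain ⟨_, ⟨f, rfl, hf⟩, hindep⟩ := hex M A B hM (h.card_lt_of_finite hA) hB
    rwa [funext (hf.apply_eq_of_subset hAM), Subtype.range_coe] at hindep

end Axioms

section Invariant

variable (L : FirstOrder.Language.{u, v}) {𝕄 : Type w} [L.Structure 𝕄] {ι : Type x}

/-- The filter on tuples whose ultrafilters are those with an `Aut(𝕄/M)`-invariant type. -/
def invariantFilter (M : Set 𝕄) : Filter (ι → 𝕄) :=
  ⨅ (σ : 𝕄 ≃[L] 𝕄) (_ : ∀ c ∈ M, σ c = c) (φ : L[[𝕄]].Formula ι),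
    𝓟 {x | φ.Realize x ↔ φ.Realize (σ.symm ∘ x)}

/-- The type of the tuple `b` over `C` extends to a global type invariant over `M`, expressed by
the consistency of `tp(b/C)` with `M`-invariance. -/
def HasInvariantExtension (M C : Set 𝕄) (b : ι → 𝕄) : Prop :=
  (typeOver L C (pure b : Filter (ι → 𝕄)) ⊓ invariantFilter L M).NeBot

variable {L} {M C B : Set 𝕄} {b : ι → 𝕄}

theorem le_invariantFilter_iff {F : Filter (ι → 𝕄)} :
    F ≤ invariantFilter L M ↔ ∀ σ : 𝕄 ≃[L] 𝕄, (∀ c ∈ M, σ c = c) → ∀ φ : L[[𝕄]].Formula ι,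
      ∀ᶠ x in F, (φ.Realize x ↔ φ.Realize (σ.symm ∘ x)) := by
  simp only [invariantFilter, le_iInf_iff, le_principal_iff]
  rfl

theorem eventually_invariantFilter_of_definable {S : Set (ι → 𝕄)} (hS : C.Definable L S)
    {σ : 𝕄 ≃[L] 𝕄} (hσ : ∀ c ∈ M, σ c = c) :
    ∀ᶠ x in invariantFilter L M, (x ∈ S ↔ σ ∘ x ∈ S) := by
  obtain ⟨φ, rfl⟩ := hS
  filter_upwards [le_invariantFilter_iff.1 le_rfl σ.symm (symm_apply_eq_of_fixing hσ)
    ((L.lhomWithConstantsMap (Subtype.val : C → 𝕄)).onFormula φ)] with x hx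
  simp only [realize_lhomWithConstantsMap_val] at hx
  exact hx

theorem definable_preimage_equiv (σ : 𝕄 ≃[L] 𝕄) {S : Set (ι → 𝕄)}
    (hS : (σ '' C).Definable L S) : C.Definable L {x | σ ∘ x ∈ S} := by
  have himage : σ '' C = range (σ ∘ ((↑) : C → 𝕄)) := by rw [range_comp, Subtype.range_coe]
  rw [himage, definable_range_iff] at hS
  obtain ⟨φ, rfl⟩ := hS
  refine definable_iff_exists_formula_sum.2 ⟨φ, ?_⟩
  ext x
  rw [mem_ofPred_eq, mem_ofPred_eq, mem_ofPred_eq, ← Sum.comp_elim,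
    StrongHomClass.realize_formula]

namespace HasInvariantExtension

theorem mono (h : HasInvariantExtension L M C b) (hBC : B ⊆ C) : HasInvariantExtension L M B b :=
  NeBot.mono h (inf_le_inf_right _ fun _ ⟨T, hT, hdef, hTS⟩ => ⟨T, hT, hdef.mono hBC, hTS⟩)

theorem comp {ι' : Type y} (h : HasInvariantExtension L M C b) (f : ι' → ι) :
    HasInvariantExtension L M C (b ∘ f) := by
  refine (NeBot.map h (· ∘ f)).mono (map_inf_le.trans (inf_le_inf ?_ ?_))
  · rintro _ ⟨T, hT, hdef, hTS⟩
    exact ⟨_, hT, hdef.preimage_comp f, preimage_mono hTS⟩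
  · refine le_invariantFilter_iff.2 fun σ hσ φ => eventually_map.2 ?_
    have hφ := le_invariantFilter_iff.1 le_rfl σ hσ (φ.relabel f)
    simp only [Formula.realize_relabel] at hφ
    exact hφ

theorem image (h : HasInvariantExtension L M C b) {σ : 𝕄 ≃[L] 𝕄} (hσ : ∀ c ∈ M, σ c = c) :
    HasInvariantExtension L M (σ '' C) (σ ∘ b) := by
  refine NeBot.mono h (le_inf ?_ inf_le_right)
  rintro _ ⟨T, hT, hdef, hTS⟩
  have hpreimage : {x | σ ∘ x ∈ T} ∈ typeOver L C (pure b) :=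
    (mem_typeOver_of_definable (definable_preimage_equiv σ hdef)).2 hT
  filter_upwards [mem_inf_of_left hpreimage,
    mem_inf_of_right (eventually_invariantFilter_of_definable hdef hσ)] with x hx hxσ
  exact hTS (hxσ.2 hx)

theorem exists_definable_of_not (h : ¬ HasInvariantExtension L M C b) :
    ∃ S : Set (ι → 𝕄), C.Definable L S ∧ b ∈ S ∧ ∀ b' ∈ S, ¬ HasInvariantExtension L M C b' := by
  rw [HasInvariantExtension, not_neBot, inf_eq_bot_iff] at h
  obtain ⟨_, ⟨T, hbT, hT, hTS⟩, U, hU, hSU⟩ := h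
  refine ⟨T, hT, hbT, fun b' hb' => not_neBot.2 (inf_eq_bot_iff.2 ⟨T, ?_, U, hU, ?_⟩)⟩
  · exact (mem_typeOver_of_definable hT).2 hb'
  · exact subset_empty_iff.1 (hSU ▸ inter_subset_inter_left U hTS)

theorem exists_extension [Finite ι] {κ : Cardinal.{w}} (hb : HasInvariantExtension L M C b)
    (h : IsMonster L 𝕄 κ) (hB : #B < κ) (hCB : C ⊆ B) :
    ∃ b', SameType L C b b' ∧ HasInvariantExtension L M B b' := by
  have : (typeOver L C (pure b : Filter (ι → 𝕄)) ⊓ invariantFilter L M).NeBot := hb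
  obtain ⟨Q, hQ⟩ := (typeOver L C (pure b) ⊓ invariantFilter L M).exists_ultrafilter_le
  obtain ⟨b', hb'⟩ := h.exists_realizes hB Q
  refine ⟨b', sameType_iff_typeOver_eq.2 ?_, Q.neBot.mono (le_inf ?_ (hQ.trans inf_le_right))⟩
  · rw [typeOver_eq_of_subset hCB hb']
    exact ((typeOver_eq_iff_le (U := pure b)).2 (hQ.trans inf_le_left)).symm
  · exact (le_typeOver _).trans hb'.ge

end HasInvariantExtension

theorem hasInvariantExtension_of_range_subset (hb : range b ⊆ M) :
    HasInvariantExtension L M C b := by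
  refine (pure_neBot (a := b)).mono (le_inf (le_typeOver _) ?_)
  refine le_invariantFilter_iff.2 fun σ hσ φ => ?_
  have hfix : σ.symm ∘ b = b :=
    funext fun i => symm_apply_eq_of_fixing hσ (b i) (hb (mem_range_self i))
  rw [eventually_pure, hfix]

theorem invIndep_iff [Nonempty 𝕄] {A : Set 𝕄} (hA : A.Finite) :
    InvIndep L A M B ↔ HasInvariantExtension L M (M ∪ B) (fun x : A => (x : 𝕄)) := by
  have : Finite A := hA
  constructor
  · rintro ⟨q, hq, hqA⟩
    obtain ⟨Q, hQ⟩ := q.exists_isTypeOfUltrafilter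
    refine Q.neBot.mono (le_inf ?_ (le_invariantFilter_iff.2 (hQ.isInvariant_iff.1 hq)))
    exact (le_typeOver _).trans (hQ.realizesRestrict_iff.1 hqA).ge
  · intro hne
    have : (typeOver L (M ∪ B) (pure fun x : A => (x : 𝕄)) ⊓ invariantFilter L M).NeBot := hne
    obtain ⟨Q, hQle⟩ := Filter.exists_ultrafilter_le
      (typeOver L (M ∪ B) (pure fun x : A => (x : 𝕄)) ⊓ invariantFilter L M)
    obtain ⟨q, hq⟩ := exists_globalType_isTypeOfUltrafilter (L := L) Q
    refine ⟨q, hq.isInvariant_iff.2 (le_invariantFilter_iff.1 (hQle.trans inf_le_right)),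
      hq.realizesRestrict_iff.2 ?_⟩
    exact ((typeOver_eq_iff_le (U := pure _)).2 (hQle.trans inf_le_left)).symm

theorem invIndep_range_iff [Nonempty 𝕄] [Finite ι] :
    InvIndep L (range b) M B ↔ HasInvariantExtension L M (M ∪ B) b := by
  rw [invIndep_iff (finite_range b)]
  refine ⟨fun h => h.comp (rangeFactorization b), fun h => ?_⟩
  have := h.comp (rangeSplitting b)
  rwa [comp_rangeSplitting] at this

theorem isIndepOver_invIndep [Nonempty 𝕄] {κ : Cardinal.{w}} (h : IsMonster L 𝕄 κ)
    (M : L.ElementarySubstructure 𝕄) (hM : #(M : Set 𝕄) < κ) :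
    IsIndepOver κ (InvIndep L) M where
  invariant σ hσ A B hA _ hAB := by
    have : Finite A := hA
    have himage := ((invIndep_iff hA).1 hAB).image hσ
    rw [image_union, image_eq_of_fixing hσ] at himage
    have hindep := invIndep_range_iff.2 himage
    rwa [range_comp, Subtype.range_coe] at hindep
  left_mono A A' B hA _ hAB hAA' :=
    (invIndep_iff (hA.subset hAA')).2 (((invIndep_iff hA).1 hAB).comp (inclusion hAA'))
  right_mono A B B' hA _ hAB hBB' :=
    (invIndep_iff hA).2 (((invIndep_iff hA).1 hAB).mono (union_subset_union_right _ hBB'))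
  strongFiniteCharacter b B _ hb := by
    simp only [invIndep_range_iff] at hb ⊢
    exact HasInvariantExtension.exists_definable_of_not hb
  extension b B B' hB' hb hBB' := by
    simp only [invIndep_range_iff] at hb ⊢
    exact hb.exists_extension h (h.card_union_lt hM hB') (union_subset_union_right _ hBB')
  of_subset A B hA _ hAM :=
    (invIndep_iff hA).2 (hasInvariantExtension_of_range_subset (by rwa [Subtype.range_coe]))

end Invariant

end AbsIndep

theorem mainTheorem2 {L : FirstOrder.Language.{u, v}} {𝕄 : Type w} [L.Structure 𝕄] [Nonempty 𝕄]
    (κ : Cardinal.{w}) (h𝕄 : AbsIndep.IsMonster L 𝕄 κ) :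
    (∀ Ind : AbsIndep.TernaryRel 𝕄,
      AbsIndep.IsIndependenceRelation L Ind →
      AbsIndep.FullExistence L κ Ind →
      AbsIndep.Monotonicity L κ Ind →
      AbsIndep.StrongFiniteCharacter L κ Ind →
      AbsIndep.RightExtension L κ Ind →
      AbsIndep.ChainLocalCharacter L κ (AbsIndep.ConantIndep L κ Ind)) ∧
    AbsIndep.ChainLocalCharacter L κ
      (AbsIndep.ConantIndep L κ (AbsIndep.InvIndep L (𝕄 := 𝕄))) :=
  ⟨fun _ hinv hex hmono hsfc hext => AbsIndep.chainLocalCharacter_conantIndep h𝕄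
    (AbsIndep.isIndepOver_of_axioms h𝕄 hinv hex hmono hsfc hext),
    AbsIndep.chainLocalCharacter_conantIndep h𝕄 (AbsIndep.isIndepOver_invIndep h𝕄)⟩
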